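/- Let $n\ge 1$ and let $M$ be a compact, connected, orientable smooth manifold (Hausdorff, without boundary) of dimension $2n+1$, and let $T^{1,0}M\subseteq\mathbb{C}TM$ be a CR structure of hypersurface type: a smooth complex subbundle of rank $n$ with $T^{1,0}M\cap T^{0,1}M=0$, where $T^{0,1}M=\overline{T^{1,0}M}$, such that the commutator of two smooth sections of $T^{1,0}M$ is a section of $T^{1,0}M$. A pseudo-Hermitian structure is a smooth nowhere vanishing real one-form $\theta$ that vanishes on $T^{1,0}M$; its Levi form is $\lambda_\theta(Z,\overline W)=\frac i4\theta([Z,\overline W])$ for sections $Z,W$ of $T^{1,0}M$. Assume that $M$ is pseudoconvex, i.e. $\lambda_\theta$ is semidefinite on $M$ for some $\theta$. The Levi distribution is $\mathcal N_p=\{Z_p\in T^{1,0}_pM:\lambda_\theta(Z_p,\overline{W}_p)=0\ \forall\, W_p\in T^{1,0}_pM\}$; it does not depend on $\theta$. **Core.** A complex distribution $\mathcal D$ on $M$ is a family of complex subspaces $\mathcal D_p\subseteq\mathbb{C}T_pM$, $p\in M$, with no regularity in $p$. Put $S_{\mathcal D}=\{p:\mathcal D_p\ne0\}$. For $A\subseteq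 M$ let $T_pA$ be the set of all $X\in T_pM$ such that $Xf=0$ for every $f\in C^\infty(M,\mathbb R)$ vanishing on $A$, and let $\mathbb{C}T_pA$ be its complexification. The derived distribution is $\mathcal D'_p=\mathcal D_p\cap\mathbb{C}T_pS_{\mathcal D}$. Put $\mathcal D^{(0)}=\mathcal D$, $\mathcal D^{(\beta+1)}=(\mathcal D^{(\beta)})'$, and $\mathcal D^{(\beta)}=\bigcap_{\gamma<\beta}\mathcal D^{(\gamma)}$ for limit ordinals $\beta$. With $\omega_1$ the first uncountable ordinal, the Levi core is $\mathfrak C(\mathcal N)=\mathcal N^{(\omega_1)}$. **D'Angelo forms.** Let $\mathcal A_M$ be the set of all real one-forms $\alpha_{\theta,T}$ defined by $\alpha_{\theta,T}(X)=\theta([T,X-\theta(X)T])$, where $\theta$ is a pseudo-Hermitian structure and $T$ is a smooth real vector field with $\theta(T)\equiv1$. Fix a smooth Hermitian metric $h$ on $\mathbb{C}TM$ and let $E$ be the orthogonal complement of $T^{1,0}M\oplus T^{0,1}M$. For a real one-form $\alpha$ write $\alpha=\alpha_{1,0}+\alpha_{0,1}$, where $\alpha_{1,0}$ vanishes on $T^{0,1}M$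 and $\alpha_{0,1}$ vanishes on $T^{1,0}M\oplus E$, and let $\overline\partial\alpha$ be the $(1,1)$-form given by $\overline\partial\alpha(Z,\overline W)=d(\alpha_{1,0})(Z,\overline W)$ for sections $Z,W$ of $T^{1,0}M$. (The wedge product and $d$ are normalized compatibly: $2(\beta\wedge\gamma)(X,Y)=\beta(X)\gamma(Y)-\beta(Y)\gamma(X)$ and $2\,d\beta(X,Y)=X(\beta(Y))-Y(\beta(X))-\beta([X,Y])$.) If $\alpha\in\mathcal A_M$, then $\overline\partial\alpha$ restricts to a Hermitian form on $\mathcal N$. Let $$\|\alpha\|_{h,\mathcal N}=\sup\{|\alpha(Z_p)|: p\in M,\ Z_p\in\mathcal N_p,\ h_p(Z_p,Z_p)=1\}\qquad(\sup\emptyset=0).$$ For a distribution $\mathcal D\subseteq\mathcal N$ and $K\in(0,+\infty]$ put $$\mathfrak n(\alpha;\mathcal D)=\inf\{t>0:\ (\overline{\alpha_{0,1}}\wedge\alpha_{0,1})(Z_p,\overline{Z_p})<t\,\overline\partial\alpha(Z_p,\overline{Z_p})\ \text{ for all } p\in M \text{ and } 0\ne Z_p\in\mathcal D_p\},$$ $$\mathfrak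 n_K(\mathcal D)=\inf\{\mathfrak n(\alpha;\mathcal D):\ \alpha\in\mathcal A_M,\ \|\alpha\|_{h,\mathcal N}<K\},$$ with $\inf\emptyset=+\infty$; both are elements of $[0,+\infty]$. **Theorem.** For every smooth Hermitian metric $h$ on $\mathbb{C}TM$ and every $K\in(0,+\infty]$, $$\mathfrak n_K(\mathcal N)=\mathfrak n_K(\mathfrak C(\mathcal N)).$$ -/

import Mathlib

open scoped Manifold ContDiff ENNReal

/-! ## Complexification of a real vector space -/

/-- The complexification `ℂ V = ℂ ⊗ V` of a real vector space `V`: formal sums `re + i im`. -/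
@[ext]
structure Complexified (V : Type*) where
  /-- real part -/
  re : V
  /-- imaginary part -/
  im : V

namespace Complexified

section

variable {V : Type*} [AddCommGroup V]

instance : Zero (Complexified V) := ⟨⟨0, 0⟩⟩
instance : Add (Complexified V) := ⟨fun v w => ⟨v.re + w.re, v.im + w.im⟩⟩
instance : Neg (Complexified V) := ⟨fun v => ⟨-v.re, -v.im⟩⟩
instance : Sub (Complexified V) := ⟨fun v w => ⟨v.re - w.re, v.im - w.im⟩⟩

@[simp] theorem zero_re : (0 : Complexified V).re = 0 := rfl
@[simp] theorem zero_im : (0 : Complexified V).im = 0 := rfl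
@[simp] theorem add_re (v w : Complexified V) : (v + w).re = v.re + w.re := rfl
@[simp] theorem add_im (v w : Complexified V) : (v + w).im = v.im + w.im := rfl
@[simp] theorem neg_re (v : Complexified V) : (-v).re = -v.re := rfl
@[simp] theorem neg_im (v : Complexified V) : (-v).im = -v.im := rfl
@[simp] theorem sub_re (v w : Complexified V) : (v - w).re = v.re - w.re := rfl
@[simp] theorem sub_im (v w : Complexified V) : (v - w).im = v.im - w.im := rfl

instance : AddCommGroup (Complexified V) where
  add_assoc a b c := by ext <;> simp [add_assoc]
  zero_add a := by ext <;> simp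
  add_zero a := by ext <;> simp
  add_comm a b := by ext <;> simp [add_comm]
  neg_add_cancel a := by ext <;> simp
  sub_eq_add_neg a b := by ext <;> simp [sub_eq_add_neg]
  nsmul := nsmulRec
  zsmul := zsmulRec

/-- Complex conjugation `re + i im ↦ re - i im`. -/
def conj (v : Complexified V) : Complexified V := ⟨v.re, -v.im⟩

@[simp] theorem conj_re (v : Complexified V) : v.conj.re = v.re := rfl
@[simp] theorem conj_im (v : Complexified V) : v.conj.im = -v.im := rfl

variable [Module ℝ V]

instance : SMul ℂ (Complexified V) :=
  ⟨fun c v => ⟨c.re • v.re - c.im • v.im, c.re • v.im + c.im • v.re⟩⟩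

@[simp] theorem smul_re (c : ℂ) (v : Complexified V) :
    (c • v).re = c.re • v.re - c.im • v.im := rfl
@[simp] theorem smul_im (c : ℂ) (v : Complexified V) :
    (c • v).im = c.re • v.im + c.im • v.re := rfl

instance : Module ℂ (Complexified V) where
  one_smul a := by ext <;> simp
  mul_smul a b v := by ext <;> simp <;> module
  smul_zero a := by ext <;> simp
  smul_add a v w := by ext <;> simp <;> module
  add_smul a b v := by ext <;> simp <;> module
  zero_smul v := by ext <;> simp

/-- The complexification of a finite-dimensional space is finite-dimensional. -/
instance [Module.Finite ℝ V] : Module.Finite ℂ (Complexified V) := by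
  let f : (V × V) →ₗ[ℝ] Complexified V :=
    { toFun := fun v => ⟨v.1, v.2⟩
      map_add' := fun _ _ => rfl
      map_smul' := fun r v => by
        change _ = (r : ℂ) • (⟨v.1, v.2⟩ : Complexified V)
        ext
        · rw [smul_re]; simp
        · rw [smul_im]; simp }
  have hf : Function.Surjective f := fun v => ⟨(v.re, v.im), rfl⟩
  have : Module.Finite ℝ (Complexified V) := Module.Finite.of_surjective f hf
  exact Module.Finite.of_restrictScalars_finite ℝ ℂ _

/-- The complexification `{X + iY : X, Y ∈ S}` of a real subspace `S`. -/
def ofReal (S : Submodule ℝ V) : Submodule ℂ (Complexified V) where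
  carrier := {v | v.re ∈ S ∧ v.im ∈ S}
  zero_mem' := ⟨S.zero_mem, S.zero_mem⟩
  add_mem' hv hw := ⟨S.add_mem hv.1 hw.1, S.add_mem hv.2 hw.2⟩
  smul_mem' _ _ hv :=
    ⟨S.sub_mem (S.smul_mem _ hv.1) (S.smul_mem _ hv.2),
      S.add_mem (S.smul_mem _ hv.2) (S.smul_mem _ hv.1)⟩

/-- The conjugate of a complex subspace. -/
def conjSubmodule (S : Submodule ℂ (Complexified V)) : Submodule ℂ (Complexified V) where
  carrier := {v | v.conj ∈ S}
  zero_mem' := by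
    have : (0 : Complexified V).conj = 0 := by ext <;> simp
    simp [this]
  add_mem' {v w} hv hw := by
    have : (v + w).conj = v.conj + w.conj := by ext <;> simp [add_comm]
    simpa [this] using S.add_mem hv hw
  smul_mem' c v hv := by
    have : (c • v).conj = (starRingEnd ℂ c) • v.conj := by
      ext
      · simp
      · simp; module
    simpa [this] using S.smul_mem _ hv

/-- The complex-linear extension `X + iY ↦ a X + i a Y` of a real functional `a`. -/
def extend (a : V →ₗ[ℝ] ℝ) : Complexified V →ₗ[ℂ] ℂ where
  toFun v := (a v.re : ℂ) + Complex.I * (a v.im : ℂ)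
  map_add' v w := by simp; ring
  map_smul' c v := by
    apply Complex.ext <;> simp

/-- The orthogonal complement with respect to a positive definite Hermitian form. -/
def orthogonal (c : InnerProductSpace.Core ℂ (Complexified V))
    (S : Submodule ℂ (Complexified V)) : Submodule ℂ (Complexified V) where
  carrier := {v | ∀ w ∈ S, c.inner v w = 0}
  zero_mem' w _ := by
    have := c.smul_left 0 w 0
    simpa using this
  add_mem' {v v'} hv hv' w hw := by rw [c.add_left, hv w hw, hv' w hw, add_zero]
  smul_mem' r v hv w hw := by rw [c.smul_left, hv w hw, mul_zero]

theorem isCompl_orthogonal [Module.Finite ℝ V]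
    (c : InnerProductSpace.Core ℂ (Complexified V))
    (S : Submodule ℂ (Complexified V)) : IsCompl S (orthogonal c S) := by
  let _ : NormedAddCommGroup (Complexified V) := c.toNormedAddCommGroup
  let _ : InnerProductSpace ℂ (Complexified V) := InnerProductSpace.ofCore c.toCore
  have h : orthogonal c S = Sᗮ := by
    ext v
    exact (Submodule.mem_orthogonal' S v).symm
  rw [h]
  exact Submodule.isCompl_orthogonal S

/-- If `A ∩ B = 0` and `E` is the orthogonal complement of `A + B`, then the whole space is the
direct sum of `B` and `A + E`. -/
theorem isCompl_sup_orthogonal [Module.Finite ℝ V]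
    (c : InnerProductSpace.Core ℂ (Complexified V))
    (A B : Submodule ℂ (Complexified V)) (hAB : A ⊓ B = ⊥) :
    IsCompl B (A ⊔ orthogonal c (A ⊔ B)) := by
  have h := isCompl_orthogonal c (A ⊔ B)
  constructor
  · exact Disjoint.disjoint_sup_right_of_disjoint_sup_left (disjoint_iff.2 hAB).symm
      (by rw [sup_comm]; exact h.disjoint)
  · rw [codisjoint_iff, ← sup_assoc, sup_comm B A]
    exact h.sup_eq_top

end

end Complexified

/-! ## Complex vector fields and forms on a real manifold of dimension `d` -/

noncomputable section

section Manifold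

variable {d : ℕ} {M : Type*} [TopologicalSpace M] [ChartedSpace (EuclideanSpace ℝ (Fin d)) M]

/-- The complexified tangent space `ℂ T_p M`. -/
abbrev CTangent (d : ℕ) {M : Type*} [TopologicalSpace M]
    [ChartedSpace (EuclideanSpace ℝ (Fin d)) M] (p : M) : Type :=
  Complexified (TangentSpace (𝓡 d) p)

/-- Real vector fields (not necessarily continuous). -/
abbrev VField (d : ℕ) (M : Type*) [TopologicalSpace M]
    [ChartedSpace (EuclideanSpace ℝ (Fin d)) M] := ∀ p : M, TangentSpace (𝓡 d) p

/-- Complex vector fields `X + iY` (not necessarily continuous). -/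
abbrev CVField (d : ℕ) (M : Type*) [TopologicalSpace M]
    [ChartedSpace (EuclideanSpace ℝ (Fin d)) M] := ∀ p : M, CTangent d p

/-- Real one-forms (not necessarily continuous). -/
abbrev OneForm (d : ℕ) (M : Type*) [TopologicalSpace M]
    [ChartedSpace (EuclideanSpace ℝ (Fin d)) M] := ∀ p : M, TangentSpace (𝓡 d) p →L[ℝ] ℝ

/-- Complex one-forms (not necessarily continuous). -/
abbrev COneForm (d : ℕ) (M : Type*) [TopologicalSpace M]
    [ChartedSpace (EuclideanSpace ℝ (Fin d)) M] := ∀ p : M, CTangent d p →ₗ[ℂ] ℂ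

/-- A complex distribution: a complex subspace of `ℂ T_p M` for every `p`, without any regularity
in `p`. -/
abbrev CDistribution (d : ℕ) (M : Type*) [TopologicalSpace M]
    [ChartedSpace (EuclideanSpace ℝ (Fin d)) M] := ∀ p : M, Submodule ℂ (CTangent d p)

/-- The complex vector field `Z̄`. -/
def CVField.conj (Z : CVField d M) : CVField d M := fun p => (Z p).conj

/-- The complex-bilinear extension of the Lie bracket to complex vector fields. -/
def CVField.bracket (Z W : CVField d M) : CVField d M := fun p =>
  ⟨VectorField.mlieBracket (𝓡 d) (fun q => (Z q).re) (fun q => (W q).re) p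
      - VectorField.mlieBracket (𝓡 d) (fun q => (Z q).im) (fun q => (W q).im) p,
    VectorField.mlieBracket (𝓡 d) (fun q => (Z q).re) (fun q => (W q).im) p
      + VectorField.mlieBracket (𝓡 d) (fun q => (Z q).im) (fun q => (W q).re) p⟩

/-- The derivative `Z f` of a complex function along a complex vector field. -/
def CVField.derivation (Z : CVField d M) (f : M → ℂ) (p : M) : ℂ :=
  mvfderiv (𝓡 d) f p (Z p).re + Complex.I * mvfderiv (𝓡 d) f p (Z p).im

/-- The complexification of a real one-form. -/
def OneForm.toComplex (a : OneForm d M) : COneForm d M := fun p =>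
  Complexified.extend (a p : TangentSpace (𝓡 d) p →ₗ[ℝ] ℝ)

/-- The conjugate form `β̄(v) = conj (β (v̄))`. -/
def COneForm.conjValue (b : COneForm d M) (p : M) (v : CTangent d p) : ℂ :=
  (starRingEnd ℂ) (b p v.conj)

/-- The exterior derivative of a complex one-form evaluated on two complex vector fields, in the
normalization `2 dβ(Z, W) = Z(β(W)) - W(β(Z)) - β([Z, W])`. -/
def COneForm.extDeriv (b : COneForm d M) (Z W : CVField d M) (p : M) : ℂ :=
  (1 / 2) * (Z.derivation (fun q => b q (W q)) p - W.derivation (fun q => b q (Z q)) p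
    - b p (Z.bracket W p))

/-- The value `(β̄ ∧ β)(v, v̄)`, in the normalization
`(β ∧ γ)(v, w) = (β(v) γ(w) - β(w) γ(v)) / 2` that goes with `COneForm.extDeriv`. -/
def COneForm.conjWedgeSelf (b : COneForm d M) (p : M) (v : CTangent d p) : ℂ :=
  (1 / 2) * (b.conjValue p v * b p v.conj - b.conjValue p v.conj * b p v)

/-- The support of a complex distribution. -/
def CDistribution.support (D : CDistribution d M) : Set M := {p | D p ≠ ⊥}

/-- The real tangent space `T_p A` to an arbitrary subset `A` of a manifold: the vectors that
annihilate every smooth function vanishing on `A`. -/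
def tangentToSet (A : Set M) (p : M) : Submodule ℝ (TangentSpace (𝓡 d) p) where
  carrier := {v | ∀ f : M → ℝ, ContMDiff (𝓡 d) 𝓘(ℝ, ℝ) ∞ f → (∀ q ∈ A, f q = 0) →
    mvfderiv (𝓡 d) f p v = 0}
  zero_mem' f _ _ := map_zero _
  add_mem' hv hw f hf hA := by rw [map_add, hv f hf hA, hw f hf hA, add_zero]
  smul_mem' c v hv f hf hA := by rw [map_smul, hv f hf hA, smul_zero]

/-- The derived distribution `D' = D ∩ ℂ T S_D`. -/
def CDistribution.derived (D : CDistribution d M) : CDistribution d M := fun p =>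
  D p ⊓ Complexified.ofReal (tangentToSet D.support p)

/-- The iterated derived distributions `D^(o)`: `D^(0) = D`, `D^(o+1) = (D^(o))'`, and
`D^(o) = ⋂_{b < o} D^(b)` at limit ordinals. -/
def CDistribution.iterDerived (D : CDistribution d M) (o : Ordinal.{0}) : CDistribution d M :=
  Ordinal.limitRecOn (motive := fun _ => CDistribution d M) o D (fun _ E => E.derived)
    (fun a _ E => fun p => ⨅ (b : Ordinal.{0}) (hb : b < a), E b hb p)

/-- The core `D^(ω₁)` of a distribution, `ω₁` being the first uncountable ordinal. -/
def CDistribution.core (D : CDistribution d M) : CDistribution d M :=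
  D.iterDerived (Ordinal.omega 1)

theorem CVField.bracket_zero_left (W : CVField d M) (p : M) :
    CVField.bracket (0 : CVField d M) W p = 0 := by
  have h : ∀ X : VField d M, VectorField.mlieBracket (𝓡 d)
      (fun q => (0 : TangentSpace (𝓡 d) q)) X p = 0 := fun X =>
    congrFun (VectorField.mlieBracket_zero_left (I := 𝓡 d) (W := X)) p
  ext1 <;> simp [CVField.bracket, h]

variable [IsManifold (𝓡 d) ∞ M]

/-- Smoothness of a real vector field on a set. -/
def VField.SmoothOn (X : VField d M) (U : Set M) : Prop :=
  ContMDiffOn (𝓡 d) (𝓡 d).tangent ∞ (fun p => (⟨p, X p⟩ : TangentBundle (𝓡 d) M)) U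

/-- Smoothness of a real vector field. -/
def VField.Smooth (X : VField d M) : Prop :=
  ContMDiff (𝓡 d) (𝓡 d).tangent ∞ (fun p => (⟨p, X p⟩ : TangentBundle (𝓡 d) M))

/-- Smoothness of a complex vector field on a set. -/
def CVField.SmoothOn (Z : CVField d M) (U : Set M) : Prop :=
  VField.SmoothOn (fun p => (Z p).re) U ∧ VField.SmoothOn (fun p => (Z p).im) U

/-- Smoothness of a complex vector field. -/
def CVField.Smooth (Z : CVField d M) : Prop :=
  VField.Smooth (fun p => (Z p).re) ∧ VField.Smooth (fun p => (Z p).im)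

/-- Smoothness of a real one-form, as a section of the cotangent bundle. -/
def OneForm.Smooth (a : OneForm d M) : Prop :=
  ContMDiff (𝓡 d) ((𝓡 d).prod 𝓘(ℝ, EuclideanSpace ℝ (Fin d) →L[ℝ] ℝ)) ∞
    (fun p => Bundle.TotalSpace.mk' (EuclideanSpace ℝ (Fin d) →L[ℝ] ℝ)
      (E := fun q : M => TangentSpace (𝓡 d) q →L[ℝ] ℝ) p (a p))

/-- `Z` is a (global) smooth section of the distribution `D`. -/
def CVField.IsSection (Z : CVField d M) (D : CDistribution d M) : Prop :=
  Z.Smooth ∧ ∀ p, Z p ∈ D p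

theorem CVField.IsSection.zero (D : CDistribution d M) : (0 : CVField d M).IsSection D :=
  ⟨⟨Bundle.contMDiff_zeroSection ℝ (TangentSpace (𝓡 d) : M → Type _),
    Bundle.contMDiff_zeroSection ℝ (TangentSpace (𝓡 d) : M → Type _)⟩, fun p => (D p).zero_mem⟩

theorem CVField.IsSection.add {D : CDistribution d M} {Z W : CVField d M}
    (hZ : Z.IsSection D) (hW : W.IsSection D) : (Z + W).IsSection D :=
  ⟨⟨hZ.1.1.add_section hW.1.1, hZ.1.2.add_section hW.1.2⟩,
    fun p => (D p).add_mem (hZ.2 p) (hW.2 p)⟩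

theorem CVField.IsSection.smul {D : CDistribution d M} {Z : CVField d M} (c : ℂ)
    (hZ : Z.IsSection D) : (c • Z).IsSection D :=
  ⟨⟨(ContMDiff.const_smul_section (a := c.re) hZ.1.1).sub_section
      (ContMDiff.const_smul_section (a := c.im) hZ.1.2),
    (ContMDiff.const_smul_section (a := c.re) hZ.1.2).add_section
      (ContMDiff.const_smul_section (a := c.im) hZ.1.1)⟩,
    fun p => (D p).smul_mem c (hZ.2 p)⟩

theorem VField.Smooth.mdifferentiableAt {X : VField d M} (hX : X.Smooth) (p : M) :
    MDifferentiableAt (𝓡 d) (𝓡 d).tangent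
      (fun q => (⟨q, X q⟩ : TangentBundle (𝓡 d) M)) p :=
  ContMDiff.mdifferentiableAt hX (by simp)

theorem VField.Smooth.mlieBracket_add {X Y : VField d M} (hX : X.Smooth) (hY : Y.Smooth)
    (W : VField d M) (p : M) :
    VectorField.mlieBracket (𝓡 d) (fun q => X q + Y q) W p =
      VectorField.mlieBracket (𝓡 d) X W p + VectorField.mlieBracket (𝓡 d) Y W p :=
  haveI : IsManifold (𝓡 d) (minSmoothness ℝ 2) M := by simp; infer_instance
  VectorField.mlieBracket_add_left (hX.mdifferentiableAt p) (hY.mdifferentiableAt p)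

theorem VField.Smooth.mlieBracket_smul {X : VField d M} (hX : X.Smooth) (c : ℝ)
    (W : VField d M) (p : M) :
    VectorField.mlieBracket (𝓡 d) (fun q => c • X q) W p =
      c • VectorField.mlieBracket (𝓡 d) X W p :=
  VectorField.mlieBracket_const_smul_left (hX.mdifferentiableAt p)

theorem CVField.Smooth.bracket_add_left {Z Z' : CVField d M} (hZ : Z.Smooth) (hZ' : Z'.Smooth)
    (W : CVField d M) (p : M) :
    CVField.bracket (Z + Z') W p = CVField.bracket Z W p + CVField.bracket Z' W p := by
  ext1
  · simp only [CVField.bracket, Pi.add_apply, Complexified.add_re, Complexified.add_im,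
      hZ.1.mlieBracket_add hZ'.1, hZ.2.mlieBracket_add hZ'.2]
    abel
  · simp only [CVField.bracket, Pi.add_apply, Complexified.add_re, Complexified.add_im,
      hZ.1.mlieBracket_add hZ'.1, hZ.2.mlieBracket_add hZ'.2]
    abel

theorem VField.Smooth.const_smul {X : VField d M} (hX : X.Smooth) (c : ℝ) :
    VField.Smooth (fun q => c • X q) :=
  ContMDiff.const_smul_section (a := c) hX

theorem VField.Smooth.mlieBracket_comb {X Y : VField d M} (hX : X.Smooth) (hY : Y.Smooth)
    (a b : ℝ) (W : VField d M) (p : M) :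
    VectorField.mlieBracket (𝓡 d) (fun q => a • X q + b • Y q) W p =
      a • VectorField.mlieBracket (𝓡 d) X W p + b • VectorField.mlieBracket (𝓡 d) Y W p := by
  rw [(hX.const_smul a).mlieBracket_add (hY.const_smul b), hX.mlieBracket_smul,
    hY.mlieBracket_smul]

theorem CVField.Smooth.bracket_smul_left {Z : CVField d M} (hZ : Z.Smooth) (c : ℂ)
    (W : CVField d M) (p : M) :
    CVField.bracket (c • Z) W p = c • CVField.bracket Z W p := by
  have e1 : (fun q => ((c • Z) q).re) = fun q => c.re • (Z q).re + (-c.im) • (Z q).im := by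
    funext q; simp [sub_eq_add_neg]
  have e2 : (fun q => ((c • Z) q).im) = fun q => c.re • (Z q).im + c.im • (Z q).re := by
    funext q; simp
  ext1
  · simp only [CVField.bracket, e1, e2, Complexified.smul_re, hZ.1.mlieBracket_comb hZ.2,
      hZ.2.mlieBracket_comb hZ.1]
    module
  · simp only [CVField.bracket, e1, e2, Complexified.smul_im, hZ.1.mlieBracket_comb hZ.2,
      hZ.2.mlieBracket_comb hZ.1]
    module

/-- A smooth Hermitian metric on the complexified tangent bundle. -/
structure HermitianMetric (d : ℕ) (M : Type*) [TopologicalSpace M]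
    [ChartedSpace (EuclideanSpace ℝ (Fin d)) M] [IsManifold (𝓡 d) ∞ M] where
  /-- a positive definite Hermitian form on every fibre -/
  core : ∀ p : M, InnerProductSpace.Core ℂ (CTangent d p)
  /-- smoothness -/
  smooth : ∀ Z W : CVField d M, Z.Smooth → W.Smooth →
    ContMDiff (𝓡 d) 𝓘(ℝ, ℂ) ∞ (fun p => (core p).inner (Z p) (W p))

/-- The `(h, D)`-size of a real one-form: the supremum of `|α(Z_p)|` over all `p` and all
`Z_p ∈ D_p` with `h_p(Z_p, Z_p) = 1`. -/
def HermitianMetric.size (h : HermitianMetric d M) (D : CDistribution d M) (a : OneForm d M) :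
    ℝ≥0∞ :=
  ⨆ (p : M) (v : CTangent d p) (_ : v ∈ D p) (_ : (h.core p).inner v v = 1), ‖a.toComplex p v‖ₑ

end Manifold

/-! ## CR manifolds of hypersurface type -/

section CR

/-- A CR structure of hypersurface type on a manifold of dimension `2n + 1`: a smooth complex
subbundle `T^{1,0}M` of rank `n` of the complexified tangent bundle, formally integrable and
meeting its conjugate only in zero. -/
structure CRStructure (n : ℕ) (M : Type*) [TopologicalSpace M]
    [ChartedSpace (EuclideanSpace ℝ (Fin (2 * n + 1))) M]
    [IsManifold (𝓡 (2 * n + 1)) ∞ M] where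
  /-- the bundle `T^{1,0}M` -/
  T10 : CDistribution (2 * n + 1) M
  /-- it has rank `n` -/
  finrank_T10 : ∀ p, Module.finrank ℂ (T10 p) = n
  /-- it is a smooth subbundle, i.e. it has smooth local frames -/
  smooth_T10 : ∀ p : M, ∃ U : Set M, IsOpen U ∧ p ∈ U ∧
    ∃ Z : Fin n → CVField (2 * n + 1) M, (∀ i, (Z i).SmoothOn U) ∧
      ∀ q ∈ U, T10 q = Submodule.span ℂ (Set.range fun i => Z i q)
  /-- `T^{1,0}M ∩ T^{0,1}M = 0` -/
  inf_conj : ∀ p, T10 p ⊓ Complexified.conjSubmodule (T10 p) = ⊥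
  /-- the commutator of two sections of `T^{1,0}M` is a section of `T^{1,0}M` -/
  integrable : ∀ Z W : CVField (2 * n + 1) M, Z.IsSection T10 → W.IsSection T10 →
    ∀ p, Z.bracket W p ∈ T10 p

namespace CRStructure

variable {n : ℕ} {M : Type*} [TopologicalSpace M]
  [ChartedSpace (EuclideanSpace ℝ (Fin (2 * n + 1))) M] [IsManifold (𝓡 (2 * n + 1)) ∞ M]

/-- The bundle `T^{0,1}M`, conjugate to `T^{1,0}M`. -/
def T01 (S : CRStructure n M) : CDistribution (2 * n + 1) M := fun p =>
  Complexified.conjSubmodule (S.T10 p)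

/-- Pseudo-Hermitian structures: smooth, nowhere vanishing, real one-forms annihilating
`T^{1,0}M`. -/
def IsPseudoHermitian (S : CRStructure n M) (θ : OneForm (2 * n + 1) M) : Prop :=
  θ.Smooth ∧ (∀ p, θ p ≠ 0) ∧ ∀ p, ∀ v ∈ S.T10 p, θ.toComplex p v = 0

/-- The Levi form `λ_θ(Z, W̄) = (i/4) θ([Z, W̄])`, for sections `Z, W` of `T^{1,0}M`. -/
def leviForm (θ : OneForm (2 * n + 1) M) (Z W : CVField (2 * n + 1) M) (p : M) : ℂ :=
  (Complex.I / 4) * θ.toComplex p (Z.bracket W.conj p)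

/-- Pseudoconvexity: the Levi form of some pseudo-Hermitian structure is semidefinite. (The
existence of a global pseudo-Hermitian structure amounts to the orientability of the
manifold.) -/
def IsPseudoconvex (S : CRStructure n M) : Prop :=
  ∃ θ, S.IsPseudoHermitian θ ∧
    ((∀ Z : CVField (2 * n + 1) M, Z.IsSection S.T10 → ∀ p, 0 ≤ (leviForm θ Z Z p).re) ∨
      (∀ Z : CVField (2 * n + 1) M, Z.IsSection S.T10 → ∀ p, (leviForm θ Z Z p).re ≤ 0))

/-- The Levi distribution: the null-distribution of the Levi form. As `λ_θ(Z, W̄)_p` depends only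
on `Z_p`, `W_p`, a vector is in the null space if and only if some section `Z` through it is
`λ_θ`-orthogonal at `p` to all sections `W` of `T^{1,0}M`; the condition is the same for all
pseudo-Hermitian structures `θ`. -/
def leviDistribution (S : CRStructure n M) : CDistribution (2 * n + 1) M := fun p =>
  { carrier := {v | ∃ Z : CVField (2 * n + 1) M, Z.IsSection S.T10 ∧ Z p = v ∧
      ∀ θ, S.IsPseudoHermitian θ → ∀ W : CVField (2 * n + 1) M, W.IsSection S.T10 →
        leviForm θ Z W p = 0}
    zero_mem' := ⟨0, CVField.IsSection.zero _, rfl, fun θ _ W _ => by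
      simp [leviForm, CVField.bracket_zero_left]⟩
    add_mem' := by
      rintro v v' ⟨Z, hZ, hv, h⟩ ⟨Z', hZ', hv', h'⟩
      refine ⟨Z + Z', hZ.add hZ', by rw [← hv, ← hv']; rfl, fun θ hθ W hW => ?_⟩
      have e := h θ hθ W hW
      have e' := h' θ hθ W hW
      unfold leviForm at e e' ⊢
      rw [hZ.1.bracket_add_left hZ'.1, map_add, mul_add, e, e', add_zero]
    smul_mem' := by
      rintro c v ⟨Z, hZ, hv, h⟩
      refine ⟨c • Z, hZ.smul c, by rw [← hv]; rfl, fun θ hθ W hW => ?_⟩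
      have e := h θ hθ W hW
      unfold leviForm at e ⊢
      rw [hZ.1.bracket_smul_left, map_smul, smul_eq_mul, mul_left_comm, e, mul_zero] }

/-- `α` is the one-form `α_{θ,T}`, `α(X) = θ([T, X - θ(X) T])`. -/
def IsDAngeloFormOf (θ : OneForm (2 * n + 1) M) (T : VField (2 * n + 1) M)
    (α : OneForm (2 * n + 1) M) : Prop :=
  ∀ X : VField (2 * n + 1) M, X.Smooth → ∀ p, α p (X p) =
    θ p (VectorField.mlieBracket (𝓡 (2 * n + 1)) T (fun q => X q - θ q (X q) • T q) p)

/-- The D'Angelo class: all one-forms `α_{θ,T}`, where `θ` is a pseudo-Hermitian structure and `T`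
is a smooth real vector field with `θ(T) = 1`. -/
def dAngeloClass (S : CRStructure n M) : Set (OneForm (2 * n + 1) M) :=
  {α | ∃ θ, S.IsPseudoHermitian θ ∧ ∃ T : VField (2 * n + 1) M, T.Smooth ∧
    (∀ p, θ p (T p) = 1) ∧ IsDAngeloFormOf θ T α}

/-- The projection of `ℂ TM = T^{1,0}M ⊕ T^{0,1}M ⊕ E` onto `T^{0,1}M`, where `E` is the
`h`-orthogonal complement of `T^{1,0}M ⊕ T^{0,1}M`. -/
def proj01 (S : CRStructure n M) (h : HermitianMetric (2 * n + 1) M) (p : M) :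
    CTangent (2 * n + 1) p →ₗ[ℂ] CTangent (2 * n + 1) p :=
  haveI : Module.Finite ℝ (TangentSpace (𝓡 (2 * n + 1)) p) :=
    inferInstanceAs (Module.Finite ℝ (EuclideanSpace ℝ (Fin (2 * n + 1))))
  Submodule.projection _ _
    (Complexified.isCompl_sup_orthogonal (h.core p) (S.T10 p) (S.T01 p) (S.inf_conj p))

/-- The component `α_{0,1}`: it agrees with `α` on `T^{0,1}M` and vanishes on `T^{1,0}M ⊕ E`. -/
def form01 (S : CRStructure n M) (h : HermitianMetric (2 * n + 1) M)
    (α : OneForm (2 * n + 1) M) : COneForm (2 * n + 1) M := fun p =>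
  α.toComplex p ∘ₗ S.proj01 h p

/-- The component `α_{1,0} = α - α_{0,1}`: it agrees with `α` on `T^{1,0}M ⊕ E` and vanishes on
`T^{0,1}M`. -/
def form10 (S : CRStructure n M) (h : HermitianMetric (2 * n + 1) M)
    (α : OneForm (2 * n + 1) M) : COneForm (2 * n + 1) M := fun p =>
  α.toComplex p - S.form01 h α p

/-- The value `∂̄α(Z, W̄)` of the `(1,1)`-form `∂̄α := ∂̄(α_{1,0})` for sections `Z, W` of
`T^{1,0}M`. As `∂̄` on `(1,0)`-forms is the `(1,1)`-component of `d`, this is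
`d(α_{1,0})(Z, W̄)`. -/
def dbar (S : CRStructure n M) (h : HermitianMetric (2 * n + 1) M) (α : OneForm (2 * n + 1) M)
    (Z W : CVField (2 * n + 1) M) (p : M) : ℂ :=
  (S.form10 h α).extDeriv Z W.conj p

/-- The strict inequality of Hermitian forms `conj(α_{0,1}) ∧ α_{0,1} < t ∂̄α` on `D ⊆ T^{1,0}M`:
it holds at all nonzero vectors `Z_p ∈ D_p`, where `Z_p` is extended to a section `Z` of
`T^{1,0}M`. -/
def HermitianLT (S : CRStructure n M) (h : HermitianMetric (2 * n + 1) M)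
    (α : OneForm (2 * n + 1) M) (t : ℝ) (D : CDistribution (2 * n + 1) M) : Prop :=
  ∀ Z : CVField (2 * n + 1) M, Z.IsSection S.T10 → ∀ p, Z p ∈ D p → Z p ≠ 0 →
    ((S.form01 h α).conjWedgeSelf p (Z p)).re < t * (S.dbar h α Z Z p).re

/-- `𝔫(α; D) = inf {t > 0 : conj(α_{0,1}) ∧ α_{0,1} < t ∂̄α on D}`, with `inf ∅ = ∞`. -/
def nForm (S : CRStructure n M) (h : HermitianMetric (2 * n + 1) M)
    (α : OneForm (2 * n + 1) M) (D : CDistribution (2 * n + 1) M) : ℝ≥0∞ :=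
  ⨅ (t : ℝ) (_ : 0 < t) (_ : S.HermitianLT h α t D), ENNReal.ofReal t

/-- `𝔫_K(D)`: the infimum of `𝔫(α; D)` over all D'Angelo forms `α` of `(h, 𝒩)`-size less than
`K`. -/
def nK (S : CRStructure n M) (h : HermitianMetric (2 * n + 1) M) (K : ℝ≥0∞)
    (D : CDistribution (2 * n + 1) M) : ℝ≥0∞ :=
  ⨅ (α : OneForm (2 * n + 1) M) (_ : α ∈ S.dAngeloClass)
    (_ : h.size S.leviDistribution α < K), S.nForm h α D

end CRStructure

end CR

end

/-!
The inequality `𝔫_K(𝔠) ≤ 𝔫_K(𝒩)` for the core `𝔠` of the Levi distribution `𝒩` is monotonicity, as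
`𝔠 ⊆ 𝒩`. For the converse it is shown that, if some D'Angelo form `α` of size less than `K`
satisfies `conj(α_{0,1}) ∧ α_{0,1} < t ∂̄α` on an iterated derived distribution `𝒩^(β)`, then some
D'Angelo form of size less than `K` satisfies it on `𝒩`, with the same `t`. The proof is by
transfinite induction on `β`, for arbitrary ordinals, and rests on the fact that all `𝒩^(β)` are
closed (`IsClosedDistribution.iterDerived`).

*Limit ordinals.* The form `α` need not be changed: by compactness of the unit sphere bundle, a
strict inequality on a decreasing intersection of closed distributions holds on one of them
(`exists_hermitianLT_of_limit`).

*Successors.* Let the inequality hold on `D'`, where `D = 𝒩^(β)`. A vector of `D` outside `D'` is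
moved by some smooth function that vanishes on the support `S_D`. By compactness, finitely many
such functions `f` suffice for `t ∂̄α - conj(α_{0,1}) ∧ α_{0,1} + t ∑ |∂f|²` to be positive on `D`
(`exists_finset_of_hermitianLT_derived`). The D'Angelo class is stable under
`α ↦ α + dg - (T g) θ`, which is the effect of `(θ, T) ↦ (e^g θ, e^{-g} T)`
(`exists_add_diffForm_mem_dAngeloClass`),
and along `T^{1,0}M` this is `α + dg`. The choice `g = -δ² ∑ sin² (f / δ)` has three properties:
`dg` vanishes on `S_D`, so that `α` is unchanged there; at the points of `S_D` the form `∂̄α`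
gains exactly `∑ |∂f|²`, independently of `δ`; and `dg` is of size `O(δ)` on all of `M`, so that
the size of the form stays below `K` for small `δ` (`exists_hermitianLT_of_derived`).

Throughout, `∂̄α(Z, W̄)` and the Levi form depend only on the values of the sections at the point.
This follows from `C^∞`-linearity and from the smoothness of the coefficients of a section in a
local frame, which Gram matrices of the Hermitian metric provide.
-/

set_option linter.unusedSectionVars false

/-! ### Linear algebra of complexifications -/

namespace Complexified

variable {V : Type*} [AddCommGroup V]

@[simp] theorem conj_conj (v : Complexified V) : v.conj.conj = v := by ext <;> simp

@[simp] theorem conj_zero : (0 : Complexified V).conj = 0 := by ext <;> simp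

theorem conj_add (v w : Complexified V) : (v + w).conj = v.conj + w.conj := by
  ext <;> simp [add_comm]

theorem sum_re {ι : Type*} (s : Finset ι) (v : ι → Complexified V) :
    (∑ i ∈ s, v i).re = ∑ i ∈ s, (v i).re :=
  map_sum (⟨⟨Complexified.re, rfl⟩, fun _ _ => rfl⟩ : Complexified V →+ V) v s

theorem sum_im {ι : Type*} (s : Finset ι) (v : ι → Complexified V) :
    (∑ i ∈ s, v i).im = ∑ i ∈ s, (v i).im :=
  map_sum (⟨⟨Complexified.im, rfl⟩, fun _ _ => rfl⟩ : Complexified V →+ V) v s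

variable [Module ℝ V]

theorem conj_smul (c : ℂ) (v : Complexified V) :
    (c • v).conj = (starRingEnd ℂ c) • v.conj := by
  ext
  · simp
  · simp; module

theorem extend_conj (a : V →ₗ[ℝ] ℝ) (v : Complexified V) :
    extend a v.conj = starRingEnd ℂ (extend a v) := by
  apply Complex.ext <;> simp [extend]

theorem mem_conjSubmodule {S : Submodule ℂ (Complexified V)} {v : Complexified V} :
    v ∈ conjSubmodule S ↔ v.conj ∈ S := Iff.rfl

end Complexified

/-! ### Calculus of complex vector fields -/

section Calculus

variable {d : ℕ} {M : Type*} [TopologicalSpace M] [ChartedSpace (EuclideanSpace ℝ (Fin d)) M]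

theorem OneForm.toComplex_apply (a : OneForm d M) (p : M) (v : CTangent d p) :
    a.toComplex p v = (a p v.re : ℂ) + Complex.I * (a p v.im : ℂ) := rfl

theorem OneForm.toComplex_conj (a : OneForm d M) (p : M) (v : CTangent d p) :
    a.toComplex p v.conj = starRingEnd ℂ (a.toComplex p v) :=
  Complexified.extend_conj _ v

/-- The differential of a real function, as a one-form. -/
noncomputable def diffForm (f : M → ℝ) : OneForm d M := fun p => mvfderiv (𝓡 d) f p

variable [IsManifold (𝓡 d) ∞ M]

theorem ContMDiff.mvfderiv_apply {F : Type*} [NormedAddCommGroup F] [NormedSpace ℝ F]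
    {f : M → F} (hf : ContMDiff (𝓡 d) 𝓘(ℝ, F) ∞ f) {X : VField d M} (hX : X.Smooth) :
    ContMDiff (𝓡 d) 𝓘(ℝ, F) ∞ (fun p => mvfderiv (𝓡 d) f p (X p)) := by
  have h1 : ContMDiff (𝓡 d).tangent 𝓘(ℝ, F).tangent ∞ (tangentMap (𝓡 d) 𝓘(ℝ, F) f) :=
    hf.contMDiff_tangentMap (by simp)
  have h2 := h1.comp hX
  intro p
  have h3 := (h2 p)
  rw [Bundle.contMDiffAt_totalSpace] at h3
  have h4 := h3.2
  simpa [tangentMap] using! h4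

theorem ContMDiff.mdifferentiableAt_top {F : Type*} [NormedAddCommGroup F] [NormedSpace ℝ F]
    {f : M → F} (hf : ContMDiff (𝓡 d) 𝓘(ℝ, F) ∞ f) (p : M) :
    MDifferentiableAt (𝓡 d) 𝓘(ℝ, F) f p := ContMDiff.mdifferentiableAt hf (by simp)

theorem OneForm.Smooth.apply {a : OneForm d M} (ha : a.Smooth) {X : VField d M} (hX : X.Smooth) :
    ContMDiff (𝓡 d) 𝓘(ℝ, ℝ) ∞ (fun p => a p (X p)) := by
  have h1 := ContMDiff.clm_bundle_apply (IM := 𝓡 d) (n := ∞) (F₁ := EuclideanSpace ℝ (Fin d))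
    (F₂ := ℝ) (E₁ := (TangentSpace (𝓡 d) : M → Type _)) (E₂ := Bundle.Trivial M ℝ) (b := id)
    (ϕ := a) (v := X) ha hX
  intro p
  have h3 := h1 p
  rw [Bundle.contMDiffAt_totalSpace] at h3
  exact h3.2

theorem VField.Smooth.mlieBracket {X Y : VField d M} (hX : X.Smooth) (hY : Y.Smooth) :
    VField.Smooth (VectorField.mlieBracket (𝓡 d) X Y) := by
  have : IsManifold (𝓡 d) ((⊤ : ℕ∞) + 1) M := inferInstanceAs (IsManifold (𝓡 d) ∞ M)
  have : IsManifold (𝓡 d) (minSmoothness ℝ 2) M := by simp; infer_instance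
  exact ContDiff.mlieBracket_vectorField (m := (⊤ : ℕ∞)) (n := (⊤ : ℕ∞)) hX hY
    (by simp only [minSmoothness_of_isRCLikeNormedField]; rfl)

theorem contMDiff_ofReal {f : M → ℝ} (hf : ContMDiff (𝓡 d) 𝓘(ℝ, ℝ) ∞ f) :
    ContMDiff (𝓡 d) 𝓘(ℝ, ℂ) ∞ (fun p => (f p : ℂ)) :=
  Complex.ofRealCLM.contMDiff.comp hf

theorem contMDiff_re {f : M → ℂ} (hf : ContMDiff (𝓡 d) 𝓘(ℝ, ℂ) ∞ f) :
    ContMDiff (𝓡 d) 𝓘(ℝ, ℝ) ∞ (fun p => (f p).re) :=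
  Complex.reCLM.contMDiff.comp hf

theorem contMDiff_im {f : M → ℂ} (hf : ContMDiff (𝓡 d) 𝓘(ℝ, ℂ) ∞ f) :
    ContMDiff (𝓡 d) 𝓘(ℝ, ℝ) ∞ (fun p => (f p).im) :=
  Complex.imCLM.contMDiff.comp hf

theorem contMDiff_conj {f : M → ℂ} (hf : ContMDiff (𝓡 d) 𝓘(ℝ, ℂ) ∞ f) :
    ContMDiff (𝓡 d) 𝓘(ℝ, ℂ) ∞ (fun p => starRingEnd ℂ (f p)) :=
  Complex.conjCLE.toContinuousLinearMap.contMDiff.comp hf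

theorem ContMDiff.complex_mul {f g : M → ℂ} (hf : ContMDiff (𝓡 d) 𝓘(ℝ, ℂ) ∞ f)
    (hg : ContMDiff (𝓡 d) 𝓘(ℝ, ℂ) ∞ g) : ContMDiff (𝓡 d) 𝓘(ℝ, ℂ) ∞ (fun p => f p * g p) :=
  (contDiff_mul (𝕜 := ℝ) (𝔸 := ℂ)).contMDiff.comp (hf.prodMk_space hg)

theorem mvfderiv_clm_comp_apply {F G : Type*} [NormedAddCommGroup F] [NormedSpace ℝ F]
    [NormedAddCommGroup G] [NormedSpace ℝ G] (L : F →L[ℝ] G) {f : M → F}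
    (hf : ContMDiff (𝓡 d) 𝓘(ℝ, F) ∞ f) (p : M) (v : TangentSpace (𝓡 d) p) :
    mvfderiv (𝓡 d) (fun q => L (f q)) p v = L (mvfderiv (𝓡 d) f p v) := by
  have h := mfderiv_comp_apply (I := 𝓡 d) (I' := 𝓘(ℝ, F)) (I'' := 𝓘(ℝ, G)) (g := L) p
    L.mdifferentiableAt (hf.mdifferentiableAt_top p) v
  rw [L.mfderiv_eq] at h
  exact h

/-- The chain rule for the composition with a function of one real variable. -/
theorem mvfderiv_real_comp_apply {u : ℝ → ℝ} (hu : ContDiff ℝ ∞ u) {f : M → ℝ}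
    (hf : ContMDiff (𝓡 d) 𝓘(ℝ, ℝ) ∞ f) (p : M) (v : TangentSpace (𝓡 d) p) :
    mvfderiv (𝓡 d) (fun q => u (f q)) p v = deriv u (f p) * mvfderiv (𝓡 d) f p v := by
  have hd : DifferentiableAt ℝ u (f p) := hu.contDiffAt.differentiableAt (by simp)
  have h := mfderiv_comp_apply (I := 𝓡 d) (I' := 𝓘(ℝ, ℝ)) (I'' := 𝓘(ℝ, ℝ)) (g := u) p
    hd.mdifferentiableAt (hf.mdifferentiableAt_top p) v
  rw [mfderiv_eq_fderiv] at h
  refine (h : _ = fderiv ℝ u (f p) (mvfderiv (𝓡 d) f p v)).trans ?_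
  exact fderiv_eq_deriv_mul (𝕜 := ℝ) (f := u)

/-- The Leibniz rule for the Lie bracket of `a X + b Y` and `W`, with functions `a`, `b`. -/
theorem VField.Smooth.mlieBracket_fun_comb {X Y : VField d M} (hX : X.Smooth) (hY : Y.Smooth)
    {a b : M → ℝ} (ha : ContMDiff (𝓡 d) 𝓘(ℝ, ℝ) ∞ a) (hb : ContMDiff (𝓡 d) 𝓘(ℝ, ℝ) ∞ b)
    (W : VField d M) (p : M) :
    VectorField.mlieBracket (𝓡 d) (fun q => a q • X q + b q • Y q) W p =
      a p • VectorField.mlieBracket (𝓡 d) X W p - mvfderiv (𝓡 d) a p (W p) • X p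
        + (b p • VectorField.mlieBracket (𝓡 d) Y W p - mvfderiv (𝓡 d) b p (W p) • Y p) := by
  have hl := VField.Smooth.mlieBracket_add (X := fun q => a q • X q) (Y := fun q => b q • Y q)
    (ha.smul_section hX) (hb.smul_section hY) W p
  have h1 := VectorField.mlieBracket_smul_left (W := W) (ha.mdifferentiableAt_top p)
    (hX.mdifferentiableAt p)
  have h2 := VectorField.mlieBracket_smul_left (W := W) (hb.mdifferentiableAt_top p)
    (hY.mdifferentiableAt p)
  rw [hl]
  refine (congrArg₂ (· + ·) h1 h2).trans ?_
  module

namespace CVField.Smooth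

variable {Z W : CVField d M}

theorem conj (hZ : Z.Smooth) : Z.conj.Smooth :=
  ⟨hZ.1, ContMDiff.neg_section hZ.2⟩

theorem smul {f : M → ℂ} (hf : ContMDiff (𝓡 d) 𝓘(ℝ, ℂ) ∞ f) (hZ : Z.Smooth) :
    CVField.Smooth (fun p => f p • Z p) :=
  ⟨((contMDiff_re hf).smul_section hZ.1).sub_section ((contMDiff_im hf).smul_section hZ.2),
    ((contMDiff_re hf).smul_section hZ.2).add_section ((contMDiff_im hf).smul_section hZ.1)⟩

theorem sum {ι : Type*} {s : Finset ι} {Z : ι → CVField d M} (hZ : ∀ i ∈ s, (Z i).Smooth) :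
    CVField.Smooth (fun p => ∑ i ∈ s, Z i p) := by
  constructor
  · simp only [Complexified.sum_re]
    exact ContMDiff.sum_section fun i hi => (hZ i hi).1
  · simp only [Complexified.sum_im]
    exact ContMDiff.sum_section fun i hi => (hZ i hi).2

theorem bracket (hZ : Z.Smooth) (hW : W.Smooth) : (Z.bracket W).Smooth :=
  ⟨(hZ.1.mlieBracket hW.1).sub_section (hZ.2.mlieBracket hW.2),
    (hZ.1.mlieBracket hW.2).add_section (hZ.2.mlieBracket hW.1)⟩

theorem derivation {f : M → ℂ} (hf : ContMDiff (𝓡 d) 𝓘(ℝ, ℂ) ∞ f) (hZ : Z.Smooth) :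
    ContMDiff (𝓡 d) 𝓘(ℝ, ℂ) ∞ (Z.derivation f) :=
  (hf.mvfderiv_apply hZ.1).add (contMDiff_const.complex_mul (hf.mvfderiv_apply hZ.2))

end CVField.Smooth

namespace CVField

theorem bracket_swap (Z W : CVField d M) (p : M) : Z.bracket W p = -(W.bracket Z p) := by
  ext1
  · simp only [bracket, Complexified.neg_re]
    rw [VectorField.mlieBracket_swap_apply (V := fun q => (Z q).re),
      VectorField.mlieBracket_swap_apply (V := fun q => (Z q).im)]
    abel
  · simp only [bracket, Complexified.neg_im]
    rw [VectorField.mlieBracket_swap_apply (V := fun q => (Z q).re),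
      VectorField.mlieBracket_swap_apply (V := fun q => (Z q).im)]
    abel

theorem derivation_add {Z : CVField d M} {f g : M → ℂ} (hf : ContMDiff (𝓡 d) 𝓘(ℝ, ℂ) ∞ f)
    (hg : ContMDiff (𝓡 d) 𝓘(ℝ, ℂ) ∞ g) (p : M) :
    Z.derivation (fun q => f q + g q) p = Z.derivation f p + Z.derivation g p := by
  simp only [derivation, mvfderiv_fun_add (hf.mdifferentiableAt_top p) (hg.mdifferentiableAt_top p),
    add_apply]
  ring

theorem derivation_mul {Z : CVField d M} {f g : M → ℂ} (hf : ContMDiff (𝓡 d) 𝓘(ℝ, ℂ) ∞ f)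
    (hg : ContMDiff (𝓡 d) 𝓘(ℝ, ℂ) ∞ g) (p : M) :
    Z.derivation (fun q => f q * g q) p = f p * Z.derivation g p + g p * Z.derivation f p := by
  have h : ∀ v : TangentSpace (𝓡 d) p, mvfderiv (𝓡 d) (fun q => f q * g q) p v =
      f p * mvfderiv (𝓡 d) g p v + g p * mvfderiv (𝓡 d) f p v := fun v =>
    congrArg (fun L : TangentSpace (𝓡 d) p →L[ℝ] ℂ => L v)
      ((hf.mdifferentiableAt_top p).hasMFDerivAt.mul
        (hg.mdifferentiableAt_top p).hasMFDerivAt).mfderiv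
  simp only [derivation, h]
  ring

/-- The Leibniz rule `[f Z, W] = f [Z, W] - (W f) Z` for a complex function `f`. -/
theorem bracket_smul_fun_left {f : M → ℂ} (hf : ContMDiff (𝓡 d) 𝓘(ℝ, ℂ) ∞ f) {Z : CVField d M}
    (hZ : Z.Smooth) (W : CVField d M) (p : M) :
    CVField.bracket (fun q => f q • Z q) W p = f p • Z.bracket W p - W.derivation f p • Z p := by
  have hre := contMDiff_re hf
  have him := contMDiff_im hf
  have e1 : (fun q => (f q • Z q).re) = fun q => (f q).re • (Z q).re + (-(f q).im) • (Z q).im := by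
    funext q; simp [sub_eq_add_neg]
  have e2 : (fun q => (f q • Z q).im) = fun q => (f q).re • (Z q).im + (f q).im • (Z q).re := rfl
  have d1 : ∀ v, mvfderiv (𝓡 d) (fun q => (f q).re) p v = (mvfderiv (𝓡 d) f p v).re :=
    mvfderiv_clm_comp_apply Complex.reCLM hf p
  have d2 : ∀ v, mvfderiv (𝓡 d) (fun q => (f q).im) p v = (mvfderiv (𝓡 d) f p v).im :=
    mvfderiv_clm_comp_apply Complex.imCLM hf p
  have d3 : ∀ v, mvfderiv (𝓡 d) (fun q => -(f q).im) p v = -(mvfderiv (𝓡 d) f p v).im :=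
    mvfderiv_clm_comp_apply (-Complex.imCLM) hf p
  have c1 := fun X => hZ.1.mlieBracket_fun_comb hZ.2 hre him.neg X p
  have c2 := fun X => hZ.2.mlieBracket_fun_comb hZ.1 hre him X p
  simp only [d1, d2, d3] at c1 c2
  ext1
  · simp only [bracket, e1, e2]
    erw [c1, c2]
    simp only [derivation, Complexified.smul_re, Complexified.sub_re, Complex.add_re,
      Complex.mul_re, Complex.add_im, Complex.mul_im, Complex.I_re, Complex.I_im]
    module
  · simp only [bracket, e1, e2]
    erw [c1, c2]
    simp only [derivation, Complexified.smul_im, Complexified.sub_im, Complex.add_re,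
      Complex.mul_re, Complex.add_im, Complex.mul_im, Complex.I_re, Complex.I_im]
    module

end CVField

end Calculus

/-! ### Gram matrices and orthogonal projections -/

theorem contDiff_matrix_det {ι : Type*} [Fintype ι] [DecidableEq ι] :
    ContDiff ℝ ∞ (fun A : ι → ι → ℂ => Matrix.det (Matrix.of A)) := by
  simp only [Matrix.det_apply, Matrix.of_apply]
  refine ContDiff.sum fun σ _ => ContDiff.const_smul _ (contDiff_prod fun i _ => ?_)
  fun_prop

theorem contDiff_matrix_adjugate {ι : Type*} [Fintype ι] [DecidableEq ι] (i j : ι) :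
    ContDiff ℝ ∞ (fun A : ι → ι → ℂ => Matrix.adjugate (Matrix.of A) i j) := by
  simp only [Matrix.adjugate_apply]
  refine contDiff_matrix_det.comp (g := fun A : ι → ι → ℂ => Matrix.det (Matrix.of A))
    (f := fun A : ι → ι → ℂ => (Matrix.of A).updateRow j (Pi.single i 1)) ?_
  refine contDiff_pi.2 fun k => contDiff_pi.2 fun l => ?_
  by_cases hk : k = j
  · subst hk
    simp only [Matrix.updateRow_self]
    exact contDiff_const
  · simp only [Matrix.updateRow_ne hk, Matrix.of_apply]
    fun_prop

namespace Complexified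

variable {V : Type*} [AddCommGroup V] [Module ℝ V]

theorem det_gram_ne_zero (c : InnerProductSpace.Core ℂ (Complexified V)) {ι : Type*} [Fintype ι]
    [DecidableEq ι] {e : ι → Complexified V} (he : LinearIndependent ℂ e) :
    Matrix.det (Matrix.of fun i j => c.inner (e i) (e j)) ≠ 0 := by
  let _ : NormedAddCommGroup (Complexified V) := c.toNormedAddCommGroup
  let _ : InnerProductSpace ℂ (Complexified V) := InnerProductSpace.ofCore c.toCore
  exact Matrix.det_gram_ne_zero_iff_linearIndependent.2 he

theorem inner_sub_sum_smul (c : InnerProductSpace.Core ℂ (Complexified V)) {ι : Type*} [Fintype ι]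
    (e : ι → Complexified V) (v w : Complexified V) (g : ι → ℂ) :
    c.inner w (v - ∑ i, g i • e i) = c.inner w v - ∑ i, g i * c.inner w (e i) := by
  let _ : NormedAddCommGroup (Complexified V) := c.toNormedAddCommGroup
  let _ : InnerProductSpace ℂ (Complexified V) := InnerProductSpace.ofCore c.toCore
  change inner ℂ w (v - ∑ i, g i • e i) = inner ℂ w v - ∑ i, g i * inner ℂ w (e i)
  rw [inner_sub_right, inner_sum]
  simp only [inner_smul_right]

theorem inner_comm_eq_zero (c : InnerProductSpace.Core ℂ (Complexified V)) {v w : Complexified V}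
    (h : c.inner v w = 0) : c.inner w v = 0 := by
  rw [← c.conj_inner_symm, h, map_zero]

end Complexified

section

variable {d : ℕ} {M : Type*} [TopologicalSpace M] [ChartedSpace (EuclideanSpace ℝ (Fin d)) M]
  [IsManifold (𝓡 d) ∞ M]

/-- A smooth function that does not vanish at `p` has a globally defined smooth function as its
inverse near `p`. -/
theorem exists_contMDiff_local_inv {f : M → ℂ} (hf : ContMDiff (𝓡 d) 𝓘(ℝ, ℂ) ∞ f) {p : M}
    (hp : f p ≠ 0) :
    ∃ r : M → ℂ, ContMDiff (𝓡 d) 𝓘(ℝ, ℂ) ∞ r ∧ ∀ᶠ q in nhds p, r q * f q = 1 := by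
  -- a smooth function on the plane which is `z⁻¹` near `f p` and vanishes near `0`
  let b : ContDiffBump (f p) := ⟨‖f p‖ / 3, ‖f p‖ / 2, by positivity,
    by linarith [norm_pos_iff.2 hp]⟩
  have hb : ContDiff ℝ ∞ (fun z : ℂ => b z • z⁻¹) := by
    rw [contDiff_iff_contDiffAt]
    intro z
    by_cases hz : z = 0
    · have : (fun z : ℂ => b z • z⁻¹) =ᶠ[nhds z] fun _ => 0 := by
        have : ∀ᶠ w in nhds z, ‖w‖ < ‖f p‖ / 2 := by
          refine continuous_norm.continuousAt.eventually_lt continuousAt_const ?_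
          simp [hz, hp]
        filter_upwards [this] with w hw
        rw [b.zero_of_le_dist, zero_smul]
        have := norm_sub_norm_le (f p) w
        rw [dist_comm, dist_eq_norm]
        change ‖f p‖ / 2 ≤ _
        linarith
      exact contDiffAt_const.congr_of_eventuallyEq this
    · exact b.contDiff.contDiffAt.smul (contDiffAt_inv ℝ hz)
  refine ⟨fun q => b (f q) • (f q)⁻¹, hb.contMDiff.comp hf, ?_⟩
  have h1 : ∀ᶠ q in nhds p, b (f q) = 1 := hf.continuous.continuousAt.eventually b.eventuallyEq_one
  have h2 : ∀ᶠ q in nhds p, f q ≠ 0 := hf.continuous.continuousAt.eventually_ne hp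
  filter_upwards [h1, h2] with q h1 h2
  rw [h1, one_smul, inv_mul_cancel₀ h2]

/-- Smooth coefficients of the orthogonal projection of a smooth field to the span of smooth fields
that are linearly independent at `p`; they are correct near `p`. -/
theorem HermitianMetric.exists_projection_coeff (h : HermitianMetric d M) {ι : Type*} [Fintype ι]
    {e : ι → CVField d M} (he : ∀ i, (e i).Smooth) {p : M}
    (hp : LinearIndependent ℂ fun i => e i p) {V : CVField d M} (hV : V.Smooth) :
    ∃ g : ι → M → ℂ, (∀ i, ContMDiff (𝓡 d) 𝓘(ℝ, ℂ) ∞ (g i)) ∧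
      ∀ᶠ q in nhds p, ∀ j, (h.core q).inner (e j q) (V q - ∑ i, g i q • e i q) = 0 := by
  classical
  let G : M → ι → ι → ℂ := fun q i j => (h.core q).inner (e i q) (e j q)
  have hG : ContMDiff (𝓡 d) 𝓘(ℝ, ι → ι → ℂ) ∞ G :=
    contMDiff_pi_space.2 fun i => contMDiff_pi_space.2 fun j => h.smooth _ _ (he i) (he j)
  obtain ⟨r, hr, hr1⟩ := exists_contMDiff_local_inv (contDiff_matrix_det.contMDiff.comp hG)
    (Complexified.det_gram_ne_zero (h.core p) hp)
  -- Cramer's rule: the inverse Gram matrix is the adjugate divided by the determinant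
  refine ⟨fun i q => r q * ∑ j, Matrix.adjugate (Matrix.of (G q)) i j *
    (h.core q).inner (e j q) (V q), fun i => hr.complex_mul (contMDiff_finsetSum fun j _ =>
      ((contDiff_matrix_adjugate i j).contMDiff.comp hG).complex_mul (h.smooth _ _ (he j) hV)), ?_⟩
  filter_upwards [hr1] with q hq k
  rw [Complexified.inner_sub_sum_smul, sub_eq_zero]
  have key := congrFun (congrArg (fun A : Matrix ι ι ℂ =>
    A.mulVec fun j => (h.core q).inner (e j q) (V q)) (Matrix.mul_adjugate (Matrix.of (G q)))) k
  simp only [← Matrix.mulVec_mulVec, Matrix.smul_mulVec, Matrix.one_mulVec, Pi.smul_apply,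
    smul_eq_mul] at key
  have key2 : ∑ i, (r q * ∑ j, Matrix.adjugate (Matrix.of (G q)) i j *
      (h.core q).inner (e j q) (V q)) * (h.core q).inner (e k q) (e i q) =
      r q * ∑ i, G q k i * ∑ j, Matrix.adjugate (Matrix.of (G q)) i j *
        (h.core q).inner (e j q) (V q) := by
    rw [Finset.mul_sum]
    exact Finset.sum_congr rfl fun i _ => by simp only [G]; ring
  rw [key2]
  refine Eq.trans ?_ (congrArg (r q * ·) key.symm)
  rw [← mul_assoc]
  exact (by rw [show r q * (Matrix.of (G q)).det = 1 from hq, one_mul])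

/-! ### Locality -/

theorem CVField.bracket_congr {Z Z' W W' : CVField d M} {p : M} (hZ : ∀ᶠ q in nhds p, Z q = Z' q)
    (hW : ∀ᶠ q in nhds p, W q = W' q) : Z.bracket W p = Z'.bracket W' p := by
  have key : ∀ {X X' Y Y' : VField d M}, (∀ᶠ q in nhds p, X q = X' q) →
      (∀ᶠ q in nhds p, Y q = Y' q) →
      VectorField.mlieBracket (𝓡 d) X Y p = VectorField.mlieBracket (𝓡 d) X' Y' p :=
    fun hX hY => Filter.EventuallyEq.mlieBracket_vectorField_eq hX hY
  have r {A B : CVField d M} (hh : ∀ᶠ q in nhds p, A q = B q) :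
    ∀ᶠ q in nhds p, (A q).re = (B q).re := hh.mono fun q hq => by rw [hq]
  have i {A B : CVField d M} (hh : ∀ᶠ q in nhds p, A q = B q) :
    ∀ᶠ q in nhds p, (A q).im = (B q).im := hh.mono fun q hq => by rw [hq]
  ext1 <;> simp only [bracket]
  · rw [key (r hZ) (r hW), key (i hZ) (i hW)]
  · rw [key (r hZ) (i hW), key (i hZ) (r hW)]

theorem CVField.derivation_congr {Z : CVField d M} {f g : M → ℂ} {p : M}
    (hf : f =ᶠ[nhds p] g) : Z.derivation f p = Z.derivation g p := by
  have : ∀ v, mvfderiv (𝓡 d) f p v = mvfderiv (𝓡 d) g p v := fun v =>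
    congrArg (fun L : TangentSpace (𝓡 d) p →L[ℝ] ℂ => L v) hf.mfderiv_eq
  simp only [derivation, this]

theorem exists_contMDiff_cutoff [T2Space M] {p : M} {U : Set M} (hU : U ∈ nhds p) :
    ∃ χ : M → ℝ, ContMDiff (𝓡 d) 𝓘(ℝ, ℝ) ∞ χ ∧ tsupport χ ⊆ U ∧ ∀ᶠ q in nhds p, χ q = 1 := by
  obtain ⟨f, -, hf⟩ := (SmoothBumpFunction.nhds_basis_tsupport (I := 𝓡 d) p).mem_iff.1 hU
  exact ⟨f, f.contMDiff, hf, f.eventuallyEq_one⟩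

theorem CVField.SmoothOn.cutoff {Z : CVField d M} {U : Set M} (hZ : Z.SmoothOn U) (hU : IsOpen U)
    {χ : M → ℝ} (hχ : ContMDiff (𝓡 d) 𝓘(ℝ, ℝ) ∞ χ) (hs : tsupport χ ⊆ U) :
    CVField.Smooth (fun q => (χ q : ℂ) • Z q) := by
  have e1 : (fun q => ((χ q : ℂ) • Z q).re) = χ • fun q => (Z q).re := by
    funext q; rw [Complexified.smul_re]; simp
  have e2 : (fun q => ((χ q : ℂ) • Z q).im) = χ • fun q => (Z q).im := by
    funext q; rw [Complexified.smul_im]; simp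
  constructor
  · rw [e1]
    exact ContMDiffOn.smul_section_of_tsupport hχ.contMDiffOn hU hs hZ.1
  · rw [e2]
    exact ContMDiffOn.smul_section_of_tsupport hχ.contMDiffOn hU hs hZ.2

theorem CVField.IsSection.sum_smul {D : CDistribution d M} {ι : Type*} (s : Finset ι)
    {E : ι → CVField d M} (hE : ∀ i, (E i).IsSection D) {f : ι → M → ℂ}
    (hf : ∀ i, ContMDiff (𝓡 d) 𝓘(ℝ, ℂ) ∞ (f i)) :
    CVField.IsSection (fun q => ∑ i ∈ s, f i q • E i q) D :=
  ⟨CVField.Smooth.sum fun i _ => CVField.Smooth.smul (hf i) (hE i).1,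
    fun q => Submodule.sum_mem _ fun i _ => Submodule.smul_mem _ _ ((hE i).2 q)⟩

/-! ### Leibniz rules for finite combinations -/

namespace CVField

theorem derivation_const (Z : CVField d M) (c : ℂ) (p : M) :
    Z.derivation (fun _ => c) p = 0 := by
  simp [derivation, mvfderiv_const]

theorem derivation_sum {ι : Type*} (s : Finset ι) (Z : CVField d M) {f : ι → M → ℂ}
    (hf : ∀ i, ContMDiff (𝓡 d) 𝓘(ℝ, ℂ) ∞ (f i)) (p : M) :
    Z.derivation (fun q => ∑ i ∈ s, f i q) p = ∑ i ∈ s, Z.derivation (f i) p := by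
  classical
  induction s using Finset.induction_on with
  | empty => simpa using derivation_const Z 0 p
  | insert i s hi ih =>
    simp only [Finset.sum_insert hi]
    rw [derivation_add (hf i) (contMDiff_finsetSum fun j _ => hf j), ih]

theorem derivation_sum_smul {ι : Type*} (s : Finset ι) (g : ι → ℂ) (Z : ι → CVField d M)
    {V : CVField d M} (f : M → ℂ) (p : M) (hV : V p = ∑ i ∈ s, g i • Z i p) :
    V.derivation f p = ∑ i ∈ s, g i * (Z i).derivation f p := by
  have e : ∀ W : CVField d M, W.derivation f p =
      mvfderiv (𝓡 d) f p (W p).re + Complex.I * mvfderiv (𝓡 d) f p (W p).im := fun _ => rfl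
  simp only [e, hV, Complexified.sum_re, Complexified.sum_im, map_sum, Complexified.smul_re,
    Complexified.smul_im, map_sub, map_add, map_smul, Finset.mul_sum, ← Finset.sum_add_distrib]
  refine Finset.sum_congr rfl fun i _ => ?_
  simp only [Complex.real_smul]
  conv_rhs => rw [← Complex.re_add_im (g i)]
  linear_combination (g i).im * mvfderiv (𝓡 d) f p (Z i p).im * (-Complex.I_sq)

theorem bracket_sum_smul_left {ι : Type*} (s : Finset ι) {f : ι → M → ℂ}
    (hf : ∀ i, ContMDiff (𝓡 d) 𝓘(ℝ, ℂ) ∞ (f i)) {Z : ι → CVField d M} (hZ : ∀ i, (Z i).Smooth)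
    (W : CVField d M) (p : M) :
    CVField.bracket (fun q => ∑ i ∈ s, f i q • Z i q) W p =
      ∑ i ∈ s, (f i p • (Z i).bracket W p - W.derivation (f i) p • Z i p) := by
  classical
  induction s using Finset.induction_on with
  | empty => exact bracket_zero_left W p
  | insert i s hi ih =>
    simp only [Finset.sum_insert hi]
    rw [← ih, ← bracket_smul_fun_left (hf i) (hZ i)]
    exact (CVField.Smooth.smul (hf i) (hZ i)).bracket_add_left
      (CVField.Smooth.sum fun j _ => CVField.Smooth.smul (hf j) (hZ j)) W p

theorem bracket_sum_smul_right {ι : Type*} (s : Finset ι) {f : ι → M → ℂ}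
    (hf : ∀ i, ContMDiff (𝓡 d) 𝓘(ℝ, ℂ) ∞ (f i)) {W : ι → CVField d M} (hW : ∀ i, (W i).Smooth)
    (Z : CVField d M) (p : M) :
    Z.bracket (fun q => ∑ i ∈ s, f i q • W i q) p =
      ∑ i ∈ s, (f i p • Z.bracket (W i) p + Z.derivation (f i) p • W i p) := by
  rw [bracket_swap, bracket_sum_smul_left s hf hW, ← Finset.sum_neg_distrib]
  refine Finset.sum_congr rfl fun i _ => ?_
  rw [bracket_swap Z (W i)]
  module

end CVField

end

namespace Complexified

variable {V : Type*} [AddCommGroup V] [Module ℝ V]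

theorem conj_sum_smul {ι : Type*} (s : Finset ι) (g : ι → ℂ) (v : ι → Complexified V) :
    (∑ i ∈ s, g i • v i).conj = ∑ i ∈ s, (starRingEnd ℂ (g i)) • (v i).conj := by
  classical
  induction s using Finset.induction_on with
  | empty => simp
  | insert i s hi ih => rw [Finset.sum_insert hi, Finset.sum_insert hi, conj_add, conj_smul, ih]

theorem linearIndependent_conj {ι : Type*} [Fintype ι] {v : ι → Complexified V}
    (hv : LinearIndependent ℂ v) : LinearIndependent ℂ fun i => (v i).conj := by
  rw [Fintype.linearIndependent_iff] at hv ⊢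
  intro g hg i
  have h1 : ∑ i, (starRingEnd ℂ (g i)) • v i = 0 := by
    have h2 := congrArg conj hg
    rw [conj_sum_smul] at h2
    simpa using h2
  simpa using hv _ h1 i

theorem conjSubmodule_span {ι : Type*} [Fintype ι] (v : ι → Complexified V) :
    conjSubmodule (Submodule.span ℂ (Set.range v)) =
      Submodule.span ℂ (Set.range fun i => (v i).conj) := by
  ext w
  rw [mem_conjSubmodule, Submodule.mem_span_range_iff_exists_fun,
    Submodule.mem_span_range_iff_exists_fun]
  constructor
  · rintro ⟨c, hc⟩
    refine ⟨fun i => starRingEnd ℂ (c i), ?_⟩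
    rw [← conj_sum_smul, hc, conj_conj]
  · rintro ⟨c, hc⟩
    refine ⟨fun i => starRingEnd ℂ (c i), ?_⟩
    rw [← hc, conj_sum_smul]
    simp

theorem mem_orthogonal_span (c : InnerProductSpace.Core ℂ (Complexified V)) {ι : Type*}
    {e : ι → Complexified V} {v : Complexified V} (h : ∀ i, c.inner (e i) v = 0) :
    v ∈ orthogonal c (Submodule.span ℂ (Set.range e)) := by
  let _ : NormedAddCommGroup (Complexified V) := c.toNormedAddCommGroup
  let _ : InnerProductSpace ℂ (Complexified V) := InnerProductSpace.ofCore c.toCore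
  intro w hw
  change inner ℂ v w = 0
  induction hw using Submodule.span_induction with
  | mem x hx =>
    obtain ⟨i, rfl⟩ := hx
    exact inner_comm_eq_zero c (h i)
  | zero => exact inner_zero_right v
  | add x y _ _ hx hy => rw [inner_add_right, hx, hy, add_zero]
  | smul a x _ hx => rw [inner_smul_right, hx, mul_zero]

theorem eq_zero_of_mem_of_mem_orthogonal (c : InnerProductSpace.Core ℂ (Complexified V))
    {S : Submodule ℂ (Complexified V)} {v : Complexified V} (h : v ∈ S) (h' : v ∈ orthogonal c S) :
    v = 0 := c.definite v (h' v h)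

end Complexified

namespace CRStructure

variable {n : ℕ} {M : Type*} [TopologicalSpace M]
  [ChartedSpace (EuclideanSpace ℝ (Fin (2 * n + 1))) M] [IsManifold (𝓡 (2 * n + 1)) ∞ M]
  (S : CRStructure n M)

/-! ### Local frames of `T^{1,0}M` -/

/-- Global sections of `T^{1,0}M` that form a frame near `p`. -/
structure IsFrameAt (E : Fin n → CVField (2 * n + 1) M) (p : M) : Prop where
  isSection : ∀ i, (E i).IsSection S.T10
  linearIndependent : LinearIndependent ℂ fun i => E i p
  span_eq : ∀ᶠ q in nhds p, S.T10 q = Submodule.span ℂ (Set.range fun i => E i q)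

theorem exists_isFrameAt [T2Space M] (p : M) : ∃ E, S.IsFrameAt E p := by
  obtain ⟨U, hU, hp, Z, hZ, hspan⟩ := S.smooth_T10 p
  obtain ⟨χ, hχ, hs, h1⟩ := exists_contMDiff_cutoff (d := 2 * n + 1) (hU.mem_nhds hp)
  have hE : ∀ q, χ q = 1 → (fun i => (χ q : ℂ) • Z i q) = fun i => Z i q := fun q hq => by
    simp [hq]
  refine ⟨fun i q => (χ q : ℂ) • Z i q, ⟨fun i => ⟨(hZ i).cutoff hU hχ hs, fun q => ?_⟩, ?_, ?_⟩⟩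
  · change (χ q : ℂ) • Z i q ∈ S.T10 q
    by_cases hq : q ∈ U
    · rw [hspan q hq]
      exact Submodule.smul_mem _ _ (Submodule.subset_span ⟨i, rfl⟩)
    · rw [image_eq_zero_of_notMem_tsupport fun h => hq (hs h)]
      simp
  · rw [hE p h1.self_of_nhds, linearIndependent_iff_card_eq_finrank_span, Set.finrank,
      ← hspan p hp, S.finrank_T10, Fintype.card_fin]
  · filter_upwards [h1, hU.mem_nhds hp] with q hq hqU
    rw [hE q hq, hspan q hqU]

variable {S}

theorem IsFrameAt.smooth {E : Fin n → CVField (2 * n + 1) M} {p : M} (hE : S.IsFrameAt E p)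
    (i : Fin n) : (E i).Smooth := (hE.isSection i).1

/-- Sections of `T^{1,0}M` have smooth coefficients in a local frame. -/
theorem IsFrameAt.exists_coeff (h : HermitianMetric (2 * n + 1) M)
    {E : Fin n → CVField (2 * n + 1) M} {p : M} (hE : S.IsFrameAt E p)
    {W : CVField (2 * n + 1) M} (hW : W.IsSection S.T10) :
    ∃ g : Fin n → M → ℂ, (∀ i, ContMDiff (𝓡 (2 * n + 1)) 𝓘(ℝ, ℂ) ∞ (g i)) ∧
      ∀ᶠ q in nhds p, W q = ∑ i, g i q • E i q := by
  obtain ⟨g, hg, hq⟩ := h.exists_projection_coeff hE.smooth hE.linearIndependent hW.1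
  refine ⟨g, hg, ?_⟩
  filter_upwards [hq, hE.span_eq] with q hq hspan
  have hmem := Complexified.mem_orthogonal_span (h.core q) hq
  rw [← hspan] at hmem
  exact sub_eq_zero.1 (Complexified.eq_zero_of_mem_of_mem_orthogonal (h.core q)
    ((S.T10 q).sub_mem (hW.2 q) ((S.T10 q).sum_mem fun i _ =>
      (S.T10 q).smul_mem _ ((hE.isSection i).2 q))) hmem)

/-! ### The projection onto `T^{0,1}M` -/

theorem proj01_of_mem_T01 (h : HermitianMetric (2 * n + 1) M) {p : M} {v : CTangent (2 * n + 1) p}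
    (hv : v ∈ S.T01 p) : S.proj01 h p v = v :=
  Submodule.projection_apply_of_mem_left _ hv

theorem proj01_of_mem_T10 (h : HermitianMetric (2 * n + 1) M) {p : M} {v : CTangent (2 * n + 1) p}
    (hv : v ∈ S.T10 p) : S.proj01 h p v = 0 :=
  Submodule.projection_apply_of_mem_right _ (Submodule.mem_sup_left hv)

theorem proj01_of_mem_orthogonal (h : HermitianMetric (2 * n + 1) M) {p : M}
    {v : CTangent (2 * n + 1) p}
    (hv : v ∈ Complexified.orthogonal (h.core p) (S.T10 p ⊔ S.T01 p)) : S.proj01 h p v = 0 :=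
  Submodule.projection_apply_of_mem_right _ (Submodule.mem_sup_right hv)

theorem conj_mem_T01 {p : M} {v : CTangent (2 * n + 1) p} (hv : v ∈ S.T10 p) :
    v.conj ∈ S.T01 p := by
  change v.conj.conj ∈ S.T10 p
  rwa [Complexified.conj_conj]

/-- The `T^{0,1}M`-component of a smooth field has smooth coefficients in a local frame. -/
theorem IsFrameAt.exists_proj01_coeff (h : HermitianMetric (2 * n + 1) M)
    {E : Fin n → CVField (2 * n + 1) M} {p : M} (hE : S.IsFrameAt E p)
    {V : CVField (2 * n + 1) M} (hV : V.Smooth) :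
    ∃ g : Fin n → M → ℂ, (∀ i, ContMDiff (𝓡 (2 * n + 1)) 𝓘(ℝ, ℂ) ∞ (g i)) ∧
      ∀ᶠ q in nhds p, S.proj01 h q (V q) = ∑ i, g i q • (E i q).conj := by
  let e : Fin n ⊕ Fin n → CVField (2 * n + 1) M := Sum.elim E fun i => (E i).conj
  have he : ∀ i, (e i).Smooth := by
    rintro (i | i)
    · exact hE.smooth i
    · exact (hE.smooth i).conj
  have hspan01 : ∀ q, S.T10 q = Submodule.span ℂ (Set.range fun i => E i q) →
      S.T01 q = Submodule.span ℂ (Set.range fun i => (E i q).conj) := fun q hq => by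
    rw [T01, hq, Complexified.conjSubmodule_span]
  have hli : LinearIndependent ℂ fun i => e i p := by
    have : (fun i => e i p) = Sum.elim (fun i => E i p) fun i => (E i p).conj := by
      funext i; rcases i with i | i <;> rfl
    rw [this]
    refine hE.linearIndependent.sum_type
      (Complexified.linearIndependent_conj hE.linearIndependent) ?_
    rw [← hE.span_eq.self_of_nhds, ← hspan01 p hE.span_eq.self_of_nhds, disjoint_iff]
    exact S.inf_conj p
  obtain ⟨g, hg, hq⟩ := h.exists_projection_coeff he hli hV
  refine ⟨fun i => g (Sum.inr i), fun i => hg _, ?_⟩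
  filter_upwards [hq, hE.span_eq] with q hq hspan
  have hmem := Complexified.mem_orthogonal_span (h.core q) hq
  have hsup : Submodule.span ℂ (Set.range fun i => e i q) = S.T10 q ⊔ S.T01 q := by
    rw [hspan01 q hspan, hspan, ← Submodule.span_union]
    congr 1
    ext v
    simp [e, CVField.conj]
  rw [hsup] at hmem
  have h0 := proj01_of_mem_orthogonal h hmem
  rw [map_sub, sub_eq_zero, Fintype.sum_sum_type, map_add] at h0
  rw [h0, proj01_of_mem_T10 h, proj01_of_mem_T01 h, zero_add]
  · rfl
  · exact Submodule.sum_mem _ fun i _ => Submodule.smul_mem _ _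
      (conj_mem_T01 ((hE.isSection i).2 q))
  · exact Submodule.sum_mem _ fun i _ => Submodule.smul_mem _ _ ((hE.isSection i).2 q)

end CRStructure

section

variable {d : ℕ} {M : Type*} [TopologicalSpace M] [ChartedSpace (EuclideanSpace ℝ (Fin d)) M]
  [IsManifold (𝓡 d) ∞ M]

/-- A real one-form that is smooth in the sense that it takes smooth vector fields to smooth
functions. -/
def OneForm.SmoothOnFields (a : OneForm d M) : Prop :=
  ∀ X : VField d M, X.Smooth → ContMDiff (𝓡 d) 𝓘(ℝ, ℝ) ∞ (fun p => a p (X p))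

theorem OneForm.Smooth.smoothOnFields {a : OneForm d M} (ha : a.Smooth) : a.SmoothOnFields :=
  fun _ hX => ha.apply hX

theorem OneForm.SmoothOnFields.toComplex_apply {a : OneForm d M} (ha : a.SmoothOnFields)
    {Z : CVField d M} (hZ : Z.Smooth) :
    ContMDiff (𝓡 d) 𝓘(ℝ, ℂ) ∞ (fun p => a.toComplex p (Z p)) :=
  (contMDiff_ofReal (ha _ hZ.1)).add (contMDiff_const.complex_mul (contMDiff_ofReal (ha _ hZ.2)))

theorem OneForm.SmoothOnFields.diffForm {f : M → ℝ} (hf : ContMDiff (𝓡 d) 𝓘(ℝ, ℝ) ∞ f) :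
    (diffForm f : OneForm d M).SmoothOnFields :=
  fun _ hX => hf.mvfderiv_apply hX

end

namespace CRStructure

variable {n : ℕ} {M : Type*} [TopologicalSpace M]
  [ChartedSpace (EuclideanSpace ℝ (Fin (2 * n + 1))) M] [IsManifold (𝓡 (2 * n + 1)) ∞ M]
  {S : CRStructure n M}

/-! ### Tensoriality -/

/-- A function of sections of `T^{1,0}M` that is local and linear over the smooth functions at `p`
depends only on the value of the section at `p`. -/
theorem congr_of_local_of_linear [T2Space M] (h : HermitianMetric (2 * n + 1) M) {p : M}
    {B : CVField (2 * n + 1) M → ℂ}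
    (hloc : ∀ Z Z' : CVField (2 * n + 1) M, Z.IsSection S.T10 → Z'.IsSection S.T10 →
      (∀ᶠ q in nhds p, Z q = Z' q) → B Z = B Z')
    (hlin : ∀ (E : Fin n → CVField (2 * n + 1) M) (f : Fin n → M → ℂ),
      (∀ i, (E i).IsSection S.T10) → (∀ i, ContMDiff (𝓡 (2 * n + 1)) 𝓘(ℝ, ℂ) ∞ (f i)) →
      B (fun q => ∑ i, f i q • E i q) = ∑ i, f i p * B (E i))
    {Z Z' : CVField (2 * n + 1) M} (hZ : Z.IsSection S.T10) (hZ' : Z'.IsSection S.T10)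
    (hp : Z p = Z' p) : B Z = B Z' := by
  obtain ⟨E, hE⟩ := S.exists_isFrameAt p
  obtain ⟨g, hg, hgZ⟩ := hE.exists_coeff h hZ
  obtain ⟨g', hg', hgZ'⟩ := hE.exists_coeff h hZ'
  rw [hloc Z _ hZ (.sum_smul _ hE.isSection hg) hgZ,
    hloc Z' _ hZ' (.sum_smul _ hE.isSection hg') hgZ', hlin E g hE.isSection hg,
    hlin E g' hE.isSection hg']
  have h0 : ∑ i, (g i p - g' i p) • E i p = 0 := by
    simp only [sub_smul, Finset.sum_sub_distrib]
    rw [← hgZ.self_of_nhds, ← hgZ'.self_of_nhds, hp, sub_self]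
  have h1 := Fintype.linearIndependent_iff.1 hE.linearIndependent _ h0
  exact Finset.sum_congr rfl fun i _ => by rw [sub_eq_zero.1 (h1 i)]

theorem leviForm_sum_smul_left {ι : Type*} (s : Finset ι) {θ : OneForm (2 * n + 1) M}
    (hθ : S.IsPseudoHermitian θ) {E : ι → CVField (2 * n + 1) M}
    (hE : ∀ i, (E i).IsSection S.T10) {f : ι → M → ℂ}
    (hf : ∀ i, ContMDiff (𝓡 (2 * n + 1)) 𝓘(ℝ, ℂ) ∞ (f i)) (W : CVField (2 * n + 1) M) (p : M) :
    leviForm θ (fun q => ∑ i ∈ s, f i q • E i q) W p = ∑ i ∈ s, f i p * leviForm θ (E i) W p := by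
  unfold leviForm
  rw [CVField.bracket_sum_smul_left s hf fun i => (hE i).1, map_sum, Finset.mul_sum]
  refine Finset.sum_congr rfl fun i _ => ?_
  rw [map_sub, map_smul, map_smul, hθ.2.2 p _ ((hE i).2 p), smul_zero, sub_zero, smul_eq_mul]
  ring

theorem leviForm_congr_left [T2Space M] (h : HermitianMetric (2 * n + 1) M)
    {θ : OneForm (2 * n + 1) M} (hθ : S.IsPseudoHermitian θ) {Z Z' : CVField (2 * n + 1) M}
    (hZ : Z.IsSection S.T10) (hZ' : Z'.IsSection S.T10) (W : CVField (2 * n + 1) M) {p : M}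
    (hp : Z p = Z' p) : leviForm θ Z W p = leviForm θ Z' W p :=
  congr_of_local_of_linear (S := S) h (B := fun Z => leviForm θ Z W p)
    (fun Z Z' _ _ hZZ' => by
      simp only [leviForm, CVField.bracket_congr hZZ' (Filter.Eventually.of_forall fun _ => rfl)])
    (fun _ _ hE hf => leviForm_sum_smul_left _ hθ hE hf W p) hZ hZ' hp

/-- Membership of `Z_p` in the Levi null space can be tested on any section `Z` through it. -/
theorem mem_leviDistribution [T2Space M] (h : HermitianMetric (2 * n + 1) M)
    {Z : CVField (2 * n + 1) M} (hZ : Z.IsSection S.T10) {p : M} :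
    Z p ∈ S.leviDistribution p ↔ ∀ θ, S.IsPseudoHermitian θ → ∀ W : CVField (2 * n + 1) M,
      W.IsSection S.T10 → leviForm θ Z W p = 0 := by
  constructor
  · rintro ⟨Z', hZ', hp, h0⟩ θ hθ W hW
    rw [leviForm_congr_left h hθ hZ hZ' W hp.symm, h0 θ hθ W hW]
  · exact fun h0 => ⟨Z, hZ, rfl, h0⟩

/-! ### The form `∂̄α` -/

theorem form10_of_mem_T10 (h : HermitianMetric (2 * n + 1) M) (α : OneForm (2 * n + 1) M) {p : M}
    {v : CTangent (2 * n + 1) p} (hv : v ∈ S.T10 p) : S.form10 h α p v = α.toComplex p v := by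
  simp [form10, form01, proj01_of_mem_T10 h hv]

theorem form10_of_mem_T01 (h : HermitianMetric (2 * n + 1) M) (α : OneForm (2 * n + 1) M) {p : M}
    {v : CTangent (2 * n + 1) p} (hv : v ∈ S.T01 p) : S.form10 h α p v = 0 := by
  simp [form10, form01, proj01_of_mem_T01 h hv]

/-- The term `Z (α_{1,0}(W̄))` of the exterior derivative is zero because `α_{1,0}` annihilates
`T^{0,1}M`, and `α_{1,0}(Z) = α(Z)`. So the metric `h` enters only through the bracket term, where
no derivative falls on the projection. -/
theorem dbar_eq (h : HermitianMetric (2 * n + 1) M) (α : OneForm (2 * n + 1) M)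
    {Z W : CVField (2 * n + 1) M} (hZ : Z.IsSection S.T10) (hW : W.IsSection S.T10) (p : M) :
    S.dbar h α Z W p = -(1 / 2) * (W.conj.derivation (fun q => α.toComplex q (Z q)) p +
      S.form10 h α p (Z.bracket W.conj p)) := by
  have e1 : (fun q => S.form10 h α q (W.conj q)) = fun _ => 0 :=
    funext fun q => form10_of_mem_T01 h α (conj_mem_T01 (hW.2 q))
  have e2 : (fun q => S.form10 h α q (Z q)) = fun q => α.toComplex q (Z q) :=
    funext fun q => form10_of_mem_T10 h α (hZ.2 q)
  rw [dbar, COneForm.extDeriv, e1, e2, CVField.derivation_const]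
  ring

/-- The derivatives of the coefficients cancel: those coming from `W̄ (α(f Z))` and those coming
from the bracket `[f Z, W̄]`, on which `α_{1,0}` and `α` agree. -/
theorem dbar_sum_smul_left {ι : Type*} (s : Finset ι) (h : HermitianMetric (2 * n + 1) M)
    {α : OneForm (2 * n + 1) M} (hα : α.SmoothOnFields) {E : ι → CVField (2 * n + 1) M}
    (hE : ∀ i, (E i).IsSection S.T10) {f : ι → M → ℂ}
    (hf : ∀ i, ContMDiff (𝓡 (2 * n + 1)) 𝓘(ℝ, ℂ) ∞ (f i)) {W : CVField (2 * n + 1) M}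
    (hW : W.IsSection S.T10) (p : M) :
    S.dbar h α (fun q => ∑ i ∈ s, f i q • E i q) W p = ∑ i ∈ s, f i p * S.dbar h α (E i) W p := by
  rw [dbar_eq h α (.sum_smul s hE hf) hW, CVField.bracket_sum_smul_left s hf
    fun i => (hE i).1]
  simp only [map_sum, map_smul, smul_eq_mul]
  rw [CVField.derivation_sum s _ fun i => (hf i).complex_mul (hα.toComplex_apply (hE i).1),
    ← Finset.sum_add_distrib, Finset.mul_sum]
  refine Finset.sum_congr rfl fun i _ => ?_
  rw [dbar_eq h α (hE i) hW, CVField.derivation_mul (hf i) (hα.toComplex_apply (hE i).1), map_sub,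
    map_smul, map_smul, form10_of_mem_T10 h α ((hE i).2 p), smul_eq_mul, smul_eq_mul]
  ring

/-- The derivatives of the coefficients appear only in `T^{0,1}M`-components of the bracket, which
`α_{1,0}` annihilates. -/
theorem dbar_sum_smul_right {ι : Type*} (s : Finset ι) (h : HermitianMetric (2 * n + 1) M)
    {α : OneForm (2 * n + 1) M} {E : ι → CVField (2 * n + 1) M}
    (hE : ∀ i, (E i).IsSection S.T10) {f : ι → M → ℂ}
    (hf : ∀ i, ContMDiff (𝓡 (2 * n + 1)) 𝓘(ℝ, ℂ) ∞ (f i)) {Z : CVField (2 * n + 1) M}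
    (hZ : Z.IsSection S.T10) (p : M) :
    S.dbar h α Z (fun q => ∑ i ∈ s, f i q • E i q) p =
      ∑ i ∈ s, starRingEnd ℂ (f i p) * S.dbar h α Z (E i) p := by
  have e : CVField.conj (fun q => ∑ i ∈ s, f i q • E i q) =
      fun q => ∑ i ∈ s, starRingEnd ℂ (f i q) • (E i).conj q :=
    funext fun q => Complexified.conj_sum_smul s _ _
  rw [dbar_eq h α hZ (.sum_smul s hE hf), e, CVField.bracket_sum_smul_right s
    (fun i => contMDiff_conj (hf i)) fun i => (hE i).1.conj,
    CVField.derivation_sum_smul s (fun i => starRingEnd ℂ (f i p)) (fun i => (E i).conj) _ p rfl,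
    map_sum, ← Finset.sum_add_distrib, Finset.mul_sum]
  refine Finset.sum_congr rfl fun i _ => ?_
  rw [dbar_eq h α hZ (hE i), map_add, map_smul, map_smul,
    form10_of_mem_T01 h α (v := (E i).conj p) (conj_mem_T01 ((hE i).2 p)), smul_eq_mul, smul_zero]
  ring

theorem dbar_congr_left [T2Space M] (h : HermitianMetric (2 * n + 1) M)
    {α : OneForm (2 * n + 1) M} (hα : α.SmoothOnFields) {Z Z' W : CVField (2 * n + 1) M}
    (hZ : Z.IsSection S.T10) (hZ' : Z'.IsSection S.T10) (hW : W.IsSection S.T10) {p : M}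
    (hp : Z p = Z' p) : S.dbar h α Z W p = S.dbar h α Z' W p :=
  congr_of_local_of_linear (S := S) h (B := fun Z => S.dbar h α Z W p)
    (fun Z Z' hZ hZ' hZZ' => by
      have e : (fun q => α.toComplex q (Z q)) =ᶠ[nhds p] fun q => α.toComplex q (Z' q) :=
        hZZ'.mono fun q hq => by simp only [hq]
      simp only [dbar_eq h α hZ hW, dbar_eq h α hZ' hW, CVField.derivation_congr e,
        CVField.bracket_congr hZZ' (Filter.Eventually.of_forall fun _ => rfl)])
    (fun _ _ hE hf => dbar_sum_smul_left _ h hα hE hf hW p) hZ hZ' hp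

theorem dbar_congr_right [T2Space M] (h : HermitianMetric (2 * n + 1) M)
    {α : OneForm (2 * n + 1) M} {Z W W' : CVField (2 * n + 1) M}
    (hZ : Z.IsSection S.T10) (hW : W.IsSection S.T10) (hW' : W'.IsSection S.T10) {p : M}
    (hp : W p = W' p) : S.dbar h α Z W p = S.dbar h α Z W' p := by
  refine (starRingEnd ℂ).injective (congr_of_local_of_linear (S := S) h (p := p)
    (B := fun W => starRingEnd ℂ (S.dbar h α Z W p)) (fun W W' hW hW' hWW' => ?_)
    (fun E f hE hf => ?_) hW hW' hp)
  · have e : ∀ᶠ q in nhds p, W.conj q = W'.conj q :=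
      hWW'.mono fun q hq => by simp only [CVField.conj, hq]
    have e2 : ∀ f, W.conj.derivation f p = W'.conj.derivation f p := fun f => by
      simp only [CVField.derivation, e.self_of_nhds]
    simp only [dbar_eq h α hZ hW, dbar_eq h α hZ hW', e2,
        CVField.bracket_congr (Filter.Eventually.of_forall fun _ => rfl) e]
  · simp only [dbar_sum_smul_right _ h hE hf hZ p, map_sum, map_mul, Complex.conj_conj]

theorem continuous_dbar [T2Space M] (h : HermitianMetric (2 * n + 1) M)
    {α : OneForm (2 * n + 1) M} (hα : α.SmoothOnFields) {Z W : CVField (2 * n + 1) M}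
    (hZ : Z.IsSection S.T10) (hW : W.IsSection S.T10) : Continuous (S.dbar h α Z W) := by
  have e : S.dbar h α Z W = fun p => -(1 / 2) *
      (W.conj.derivation (fun q => α.toComplex q (Z q)) p +
        (α.toComplex p (Z.bracket W.conj p) -
          α.toComplex p (S.proj01 h p (Z.bracket W.conj p)))) := funext (dbar_eq h α hZ hW)
  have hb := hZ.1.bracket hW.1.conj
  have h1 := (CVField.Smooth.derivation (hα.toComplex_apply hZ.1) hW.1.conj).continuous
  have h2 := (hα.toComplex_apply hb).continuous
  have h3 : Continuous fun p => α.toComplex p (S.proj01 h p (Z.bracket W.conj p)) := by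
    rw [continuous_iff_continuousAt]
    intro p
    obtain ⟨E, hE⟩ := S.exists_isFrameAt p
    obtain ⟨g, hg, hq⟩ := hE.exists_proj01_coeff h hb
    have h4 : Continuous fun q => ∑ i, g i q * α.toComplex q ((E i).conj q) :=
      continuous_finsetSum _ fun i _ => (hg i).continuous.mul
        (hα.toComplex_apply (hE.smooth i).conj).continuous
    refine h4.continuousAt.congr ?_
    filter_upwards [hq] with q hq
    rw [hq, map_sum]
    simp only [map_smul, smul_eq_mul]
    rfl
  rw [e]
  fun_prop

/-- On a vector `v` of `T^{1,0}M` the form `conj(α_{0,1}) ∧ α_{0,1}` has the value `|α(v)|² / 2`;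
the projection to `T^{0,1}M` disappears from it. -/
theorem conjWedgeSelf_form01 (h : HermitianMetric (2 * n + 1) M) (α : OneForm (2 * n + 1) M)
    {p : M} {v : CTangent (2 * n + 1) p} (hv : v ∈ S.T10 p) :
    ((S.form01 h α).conjWedgeSelf p v).re = 1 / 2 * ‖α.toComplex p v‖ ^ 2 := by
  have h1 : S.form01 h α p v = 0 := by simp [form01, proj01_of_mem_T10 h hv]
  have h2 : S.form01 h α p v.conj = starRingEnd ℂ (α.toComplex p v) := by
    simp [form01, proj01_of_mem_T01 h (conj_mem_T01 hv), OneForm.toComplex_conj]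
  rw [COneForm.conjWedgeSelf, COneForm.conjValue, COneForm.conjValue, h1, h2, mul_zero, sub_zero,
    Complex.conj_conj, Complex.mul_conj, Complex.normSq_eq_norm_sq]
  norm_num [← Complex.ofReal_pow]

end CRStructure

/-! ### Closed distributions -/

section

variable {d : ℕ} {M : Type*} [TopologicalSpace M] [ChartedSpace (EuclideanSpace ℝ (Fin d)) M]
  [IsManifold (𝓡 d) ∞ M]

/-- The combination of complex vector fields with constant coefficients. -/
noncomputable def CVField.comb {ι : Type*} [Fintype ι] (E : ι → CVField d M) (c : ι → ℂ) :
    CVField d M :=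
  fun q => ∑ i, c i • E i q

theorem CVField.comb_smul {ι : Type*} [Fintype ι] (E : ι → CVField d M) (r : ℂ) (c : ι → ℂ)
    (q : M) : comb E (r • c) q = r • comb E c q := by
  simp [comb, Finset.smul_sum, mul_smul]

theorem CVField.IsSection.comb {ι : Type*} [Fintype ι] {D : CDistribution d M}
    {E : ι → CVField d M} (hE : ∀ i, (E i).IsSection D) (c : ι → ℂ) :
    (CVField.comb E c).IsSection D :=
  .sum_smul Finset.univ hE fun _ => contMDiff_const

theorem OneForm.SmoothOnFields.continuous_comb {ι : Type*} [Fintype ι] {a : OneForm d M}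
    (ha : a.SmoothOnFields) {E : ι → CVField d M} (hE : ∀ i, (E i).Smooth) :
    Continuous fun x : M × (ι → ℂ) => a.toComplex x.1 (CVField.comb E x.2 x.1) := by
  simp only [CVField.comb, map_sum, map_smul, smul_eq_mul]
  refine continuous_finsetSum _ fun i _ => Continuous.mul (by fun_prop) ?_
  exact (ha.toComplex_apply (hE i)).continuous.comp continuous_fst

theorem HermitianMetric.continuous_comb (h : HermitianMetric d M) {ι : Type*} [Fintype ι]
    {E : ι → CVField d M} (hE : ∀ i, (E i).Smooth) :
    Continuous fun x : M × (ι → ℂ) =>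
      (h.core x.1).inner (CVField.comb E x.2 x.1) (CVField.comb E x.2 x.1) := by
  have key : ∀ x : M × (ι → ℂ), (h.core x.1).inner (CVField.comb E x.2 x.1) (CVField.comb E x.2 x.1)
      = ∑ i, starRingEnd ℂ (x.2 i) * ∑ j, x.2 j * (h.core x.1).inner (E i x.1) (E j x.1) := by
    intro x
    let _ : NormedAddCommGroup (CTangent d x.1) := (h.core x.1).toNormedAddCommGroup
    let _ : InnerProductSpace ℂ (CTangent d x.1) := InnerProductSpace.ofCore (h.core x.1).toCore
    change inner ℂ (∑ i, x.2 i • E i x.1) (∑ i, x.2 i • E i x.1) =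
      ∑ i, starRingEnd ℂ (x.2 i) * ∑ j, x.2 j * inner ℂ (E i x.1) (E j x.1)
    simp only [sum_inner, inner_sum, inner_smul_left, inner_smul_right, Finset.mul_sum]
    rw [Finset.sum_comm]
    exact Finset.sum_congr rfl fun i _ => Finset.sum_congr rfl fun j _ => by ring
  simp only [key]
  refine continuous_finsetSum _ fun i _ => Continuous.mul ?_ (continuous_finsetSum _ fun j _ =>
    Continuous.mul (by fun_prop) ((h.smooth _ _ (hE i) (hE j)).continuous.comp continuous_fst))
  exact Complex.continuous_conj.comp (by fun_prop)

theorem HermitianMetric.inner_smul_self (h : HermitianMetric d M) (p : M) (c : ℂ)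
    (v : CTangent d p) : ((h.core p).inner (c • v) (c • v)).re =
      ‖c‖ ^ 2 * ((h.core p).inner v v).re := by
  let _ : NormedAddCommGroup (CTangent d p) := (h.core p).toNormedAddCommGroup
  let _ : InnerProductSpace ℂ (CTangent d p) := InnerProductSpace.ofCore (h.core p).toCore
  change (inner ℂ (c • v) (c • v)).re = ‖c‖ ^ 2 * (inner ℂ v v).re
  rw [inner_smul_left, inner_smul_right, ← mul_assoc, mul_comm ((starRingEnd ℂ) c),
    Complex.mul_conj, Complex.re_ofReal_mul, Complex.normSq_eq_norm_sq]

theorem HermitianMetric.inner_self_nonneg (h : HermitianMetric d M) (p : M) (v : CTangent d p) :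
    0 ≤ ((h.core p).inner v v).re := (h.core p).re_inner_nonneg v

theorem HermitianMetric.inner_self_pos (h : HermitianMetric d M) {p : M} {v : CTangent d p}
    (hv : v ≠ 0) : 0 < ((h.core p).inner v v).re := by
  let _ : NormedAddCommGroup (CTangent d p) := (h.core p).toNormedAddCommGroup
  let _ : InnerProductSpace ℂ (CTangent d p) := InnerProductSpace.ofCore (h.core p).toCore
  have h1 : (inner ℂ v v).re = ‖v‖ ^ 2 := (inner_self_eq_norm_sq (𝕜 := ℂ) v)
  exact h1 ▸ pow_pos (norm_pos_iff.2 hv) 2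

/-- The complexified tangent space to a set is cut out by the complexified differentials of the
functions vanishing on the set. -/
theorem mem_ofReal_tangentToSet {A : Set M} {p : M} {v : CTangent d p} :
    v ∈ Complexified.ofReal (tangentToSet A p) ↔ ∀ f : M → ℝ, ContMDiff (𝓡 d) 𝓘(ℝ, ℝ) ∞ f →
      (∀ q ∈ A, f q = 0) → (diffForm f : OneForm d M).toComplex p v = 0 := by
  have key : ∀ f : M → ℝ, (diffForm f : OneForm d M).toComplex p v = 0 ↔
      mvfderiv (𝓡 d) f p v.re = 0 ∧ mvfderiv (𝓡 d) f p v.im = 0 := fun f => by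
    rw [OneForm.toComplex_apply, Complex.ext_iff]
    simp [diffForm]
  simp only [key]
  exact ⟨fun hv f hf hA => ⟨hv.1 f hf hA, hv.2 f hf hA⟩,
    fun hv => ⟨fun f hf hA => (hv f hf hA).1, fun f hf hA => (hv f hf hA).2⟩⟩

/-! ### The derived sequence -/

namespace CDistribution

variable (D : CDistribution d M)

theorem iterDerived_zero : D.iterDerived 0 = D := Ordinal.limitRecOn_zero ..

theorem iterDerived_add_one (o : Ordinal.{0}) : D.iterDerived (o + 1) = (D.iterDerived o).derived :=
  Ordinal.limitRecOn_add_one ..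

theorem mem_iterDerived_limit {o : Ordinal.{0}} (ho : Order.IsSuccLimit o) {p : M}
    {v : CTangent d p} : v ∈ D.iterDerived o p ↔ ∀ b < o, v ∈ D.iterDerived b p := by
  have e : D.iterDerived o = fun p => ⨅ (b : Ordinal.{0}) (_ : b < o), D.iterDerived b p :=
    Ordinal.limitRecOn_limit _ _ _ _ ho
  rw [e]
  simp only [Submodule.mem_iInf]

theorem iterDerived_antitone : Antitone D.iterDerived := by
  intro a b hab
  induction b using Ordinal.limitRecOn with
  | zero => rw [le_antisymm hab zero_le]
  | add_one b ih =>
    rcases hab.eq_or_lt with rfl | hlt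
    · exact le_rfl
    · rw [iterDerived_add_one]
      exact le_trans (fun p => inf_le_left) (ih (Order.lt_add_one_iff.1 hlt))
  | limit b hb _ =>
    rcases hab.eq_or_lt with rfl | hlt
    · exact le_rfl
    · exact fun p v hv => (D.mem_iterDerived_limit hb).1 hv a hlt

theorem core_le (p : M) : D.core p ≤ D p := by
  have := D.iterDerived_antitone (zero_le (a := Ordinal.omega 1)) p
  rwa [iterDerived_zero] at this

end CDistribution

end

namespace CRStructure

variable {n : ℕ} {M : Type*} [TopologicalSpace M]
  [ChartedSpace (EuclideanSpace ℝ (Fin (2 * n + 1))) M] [IsManifold (𝓡 (2 * n + 1)) ∞ M]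
  (S : CRStructure n M)

/-- A distribution is relatively closed in `T^{1,0}M`. As the topology of the total space is read
off in local frames, the condition is that, for all sections `E₁, …, Eₙ` of `T^{1,0}M`, the set of
all `(q, c)` with `∑ cᵢ Eᵢ(q) ∈ D_q` is closed in `M × ℂⁿ`. -/
def IsClosedDistribution (D : CDistribution (2 * n + 1) M) : Prop :=
  ∀ E : Fin n → CVField (2 * n + 1) M, (∀ i, (E i).IsSection S.T10) →
    IsClosed {x : M × (Fin n → ℂ) | CVField.comb E x.2 x.1 ∈ D x.1}

variable {S}

theorem IsClosedDistribution.derived {D : CDistribution (2 * n + 1) M}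
    (hD : S.IsClosedDistribution D) : S.IsClosedDistribution D.derived := by
  intro E hE
  have e : {x : M × (Fin n → ℂ) | CVField.comb E x.2 x.1 ∈ D.derived x.1} =
      {x | CVField.comb E x.2 x.1 ∈ D x.1} ∩ ⋂ (f : M → ℝ)
        (_ : ContMDiff (𝓡 (2 * n + 1)) 𝓘(ℝ, ℝ) ∞ f) (_ : ∀ q ∈ D.support, f q = 0),
        {x | (diffForm f : OneForm (2 * n + 1) M).toComplex x.1 (CVField.comb E x.2 x.1) = 0} := by
    ext x
    simp only [CDistribution.derived, Submodule.mem_inf, mem_ofReal_tangentToSet, Set.mem_ofPred_eq,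
      Set.mem_inter_iff, Set.mem_iInter]
  rw [e]
  refine (hD E hE).inter (isClosed_iInter fun f => isClosed_iInter fun hf => isClosed_iInter
    fun _ => isClosed_eq ?_ continuous_const)
  exact (OneForm.SmoothOnFields.diffForm hf).continuous_comb fun i => (hE i).1

theorem IsClosedDistribution.iterDerived {D : CDistribution (2 * n + 1) M}
    (hD : S.IsClosedDistribution D) (o : Ordinal.{0}) :
    S.IsClosedDistribution (D.iterDerived o) := by
  induction o using Ordinal.limitRecOn with
  | zero => rwa [CDistribution.iterDerived_zero]
  | add_one b ih => rw [CDistribution.iterDerived_add_one]; exact ih.derived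
  | limit b hb ih =>
    intro E hE
    simp only [D.mem_iterDerived_limit hb, Set.ofPred_forall]
    exact isClosed_iInter fun a => isClosed_iInter fun ha => ih a ha E hE

theorem isClosedDistribution_leviDistribution [T2Space M] (h : HermitianMetric (2 * n + 1) M) :
    S.IsClosedDistribution S.leviDistribution := by
  intro E hE
  have key : ∀ x : M × (Fin n → ℂ), CVField.comb E x.2 x.1 ∈ S.leviDistribution x.1 ↔
      ∀ θ, S.IsPseudoHermitian θ → ∀ W : CVField (2 * n + 1) M, W.IsSection S.T10 →
        ∑ i, x.2 i * leviForm θ (E i) W x.1 = 0 := fun x => by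
    rw [mem_leviDistribution h (CVField.IsSection.comb hE x.2)]
    refine forall_congr' fun θ => forall_congr' fun hθ => forall_congr' fun W => forall_congr'
      fun _ => ?_
    rw [← leviForm_sum_smul_left Finset.univ hθ hE (f := fun i _ => x.2 i)
      (fun i => contMDiff_const) W x.1]
    rfl
  simp only [key, Set.ofPred_forall]
  refine isClosed_iInter fun θ => isClosed_iInter fun hθ => isClosed_iInter fun W =>
    isClosed_iInter fun hW => isClosed_eq (continuous_finsetSum _ fun i _ => ?_) continuous_const
  refine Continuous.mul (by fun_prop)
    (Continuous.comp (g := fun p => leviForm θ (E i) W p) ?_ continuous_fst)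
  exact continuous_const.mul
    (hθ.1.smoothOnFields.toComplex_apply ((hE i).1.bracket hW.1.conj)).continuous

/-! ### A compactness principle -/

/-- A directed family of conditions on the nonzero vectors of `T^{1,0}M`, invariant under positive
dilations, has a member that holds everywhere as soon as every nonzero vector has a neighbourhood
in which some member holds. -/
theorem exists_index_of_local [T2Space M] [CompactSpace M] {I : Type*} [Nonempty I]
    (P : I → ∀ q : M, CTangent (2 * n + 1) q → Prop)
    (hdir : ∀ i j, ∃ k, ∀ q v, P i q v ∨ P j q v → P k q v)
    (hscale : ∀ i q v (r : ℝ), 0 < r → P i q ((r : ℂ) • v) → P i q v)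
    (hloc : ∀ E : Fin n → CVField (2 * n + 1) M, (∀ i, (E i).IsSection S.T10) →
      ∀ (p : M) (c : Fin n → ℂ), CVField.comb E c p ≠ 0 →
        ∃ i, ∀ᶠ x : M × (Fin n → ℂ) in nhds (p, c), P i x.1 (CVField.comb E x.2 x.1)) :
    ∃ i, ∀ q, ∀ v ∈ S.T10 q, v ≠ 0 → P i q v := by
  have hpt : ∀ p : M, ∃ i, ∀ᶠ q in nhds p, ∀ v ∈ S.T10 q, v ≠ 0 → P i q v := by
    intro p
    obtain ⟨E, hE⟩ := S.exists_isFrameAt p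
    -- by homogeneity it is enough to treat the compact unit sphere of coefficients in a frame
    have hsph : ∃ i, ∀ᶠ q in nhds p, ∀ c ∈ Metric.sphere (0 : Fin n → ℂ) 1,
        P i q (CVField.comb E c q) := by
      refine (isCompact_sphere (0 : Fin n → ℂ) 1).induction_on
        (p := fun s => ∃ i, ∀ᶠ q in nhds p, ∀ c ∈ s, P i q (CVField.comb E c q)) ?_ ?_ ?_ ?_
      · exact ⟨Classical.arbitrary I, by simp⟩
      · rintro s t hst ⟨i, hi⟩
        exact ⟨i, hi.mono fun q hq c hc => hq c (hst hc)⟩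
      · rintro s t ⟨i, hi⟩ ⟨j, hj⟩
        obtain ⟨k, hk⟩ := hdir i j
        refine ⟨k, ?_⟩
        filter_upwards [hi, hj] with q hqi hqj c hc
        exact hk _ _ (hc.imp (hqi c) (hqj c))
      · intro c hc
        have hne : CVField.comb E c p ≠ 0 := fun h0 => by
          have := Fintype.linearIndependent_iff.1 hE.linearIndependent c h0
          rw [show c = 0 from funext this] at hc
          simp at hc
        obtain ⟨i, hi⟩ := hloc E hE.isSection p c hne
        rw [nhds_prod_eq, Filter.eventually_prod_iff] at hi
        obtain ⟨pa, ha, pb, hb, hab⟩ := hi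
        exact ⟨{c | pb c}, mem_nhdsWithin_of_mem_nhds hb, i, ha.mono fun q hq c hc => hab hq hc⟩
    obtain ⟨i, hi⟩ := hsph
    refine ⟨i, ?_⟩
    filter_upwards [hi, hE.span_eq] with q hq hspan v hv hv0
    rw [hspan, Submodule.mem_span_range_iff_exists_fun] at hv
    obtain ⟨c, rfl⟩ := hv
    have hc : c ≠ 0 := by
      rintro rfl
      simp at hv0
    have hpos : 0 < ‖c‖⁻¹ := inv_pos.2 (norm_pos_iff.2 hc)
    refine hscale i q _ ‖c‖⁻¹ hpos ?_
    have := hq (((‖c‖⁻¹ : ℝ) : ℂ) • c) (by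
      rw [mem_sphere_zero_iff_norm, norm_smul, Complex.norm_real, norm_inv, norm_norm,
        inv_mul_cancel₀ (norm_ne_zero_iff.2 hc)])
    rwa [CVField.comb_smul] at this
  have huniv : ∃ i, ∀ q ∈ (Set.univ : Set M), ∀ v ∈ S.T10 q, v ≠ 0 → P i q v := by
    refine isCompact_univ.induction_on
      (p := fun s : Set M => ∃ i, ∀ q ∈ s, ∀ v ∈ S.T10 q, v ≠ 0 → P i q v) ?_ ?_ ?_ ?_
    · exact ⟨Classical.arbitrary I, by simp⟩
    · rintro s t hst ⟨i, hi⟩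
      exact ⟨i, fun q hq => hi q (hst hq)⟩
    · rintro s t ⟨i, hi⟩ ⟨j, hj⟩
      obtain ⟨k, hk⟩ := hdir i j
      exact ⟨k, fun q hq v hv hv0 => hk _ _ (hq.imp (fun h => hi q h v hv hv0)
        fun h => hj q h v hv hv0)⟩
    · intro p _
      obtain ⟨i, hi⟩ := hpt p
      exact ⟨_, mem_nhdsWithin_of_mem_nhds hi, i, fun q hq => hq⟩
  obtain ⟨i, hi⟩ := huniv
  exact ⟨i, fun q => hi q trivial⟩

/-! ### The form `t ∂̄α - conj(α_{0,1}) ∧ α_{0,1}` -/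

variable (S) in
/-- The value at `Z_p` of the Hermitian form `t ∂̄α - conj(α_{0,1}) ∧ α_{0,1}`, for a section `Z` of
`T^{1,0}M`. -/
noncomputable def gap (h : HermitianMetric (2 * n + 1) M) (α : OneForm (2 * n + 1) M) (t : ℝ)
    (Z : CVField (2 * n + 1) M) (p : M) : ℝ :=
  t * (S.dbar h α Z Z p).re - 1 / 2 * ‖α.toComplex p (Z p)‖ ^ 2

theorem hermitianLT_iff (h : HermitianMetric (2 * n + 1) M) (α : OneForm (2 * n + 1) M) (t : ℝ)
    (D : CDistribution (2 * n + 1) M) : S.HermitianLT h α t D ↔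
      ∀ Z : CVField (2 * n + 1) M, Z.IsSection S.T10 → ∀ p, Z p ∈ D p → Z p ≠ 0 →
        0 < S.gap h α t Z p := by
  refine forall_congr' fun Z => forall_congr' fun hZ => forall_congr' fun p => ?_
  rw [conjWedgeSelf_form01 h α (hZ.2 p), gap, sub_pos]

theorem gap_congr [T2Space M] (h : HermitianMetric (2 * n + 1) M) {α : OneForm (2 * n + 1) M}
    (hα : α.SmoothOnFields) (t : ℝ) {Z Z' : CVField (2 * n + 1) M} (hZ : Z.IsSection S.T10)
    (hZ' : Z'.IsSection S.T10) {p : M} (hp : Z p = Z' p) :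
    S.gap h α t Z p = S.gap h α t Z' p := by
  rw [gap, gap, dbar_congr_left h hα hZ hZ' hZ hp, dbar_congr_right h hZ' hZ hZ' hp, hp]

theorem dbar_comb {ι : Type*} [Fintype ι] (h : HermitianMetric (2 * n + 1) M)
    {α : OneForm (2 * n + 1) M} (hα : α.SmoothOnFields) {E : ι → CVField (2 * n + 1) M}
    (hE : ∀ i, (E i).IsSection S.T10) (c : ι → ℂ) (p : M) :
    S.dbar h α (CVField.comb E c) (CVField.comb E c) p =
      ∑ i, c i * ∑ j, starRingEnd ℂ (c j) * S.dbar h α (E i) (E j) p := by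
  refine (dbar_sum_smul_left Finset.univ h hα hE (f := fun i _ => c i) (fun _ => contMDiff_const)
    (CVField.IsSection.comb hE c) p).trans (Finset.sum_congr rfl fun i _ => congrArg _ ?_)
  exact dbar_sum_smul_right Finset.univ h hE (f := fun i _ => c i) (fun _ => contMDiff_const)
    (hE i) p

theorem gap_smul (h : HermitianMetric (2 * n + 1) M) {α : OneForm (2 * n + 1) M}
    (hα : α.SmoothOnFields) (t : ℝ) {Z : CVField (2 * n + 1) M} (hZ : Z.IsSection S.T10) (c : ℂ)
    (p : M) : S.gap h α t (c • Z) p = ‖c‖ ^ 2 * S.gap h α t Z p := by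
  have e : c • Z = CVField.comb (fun _ : Unit => Z) fun _ => c := by
    funext q; simp [CVField.comb]
  have e2 : S.dbar h α (c • Z) (c • Z) p = ((‖c‖ ^ 2 : ℝ) : ℂ) * S.dbar h α Z Z p := by
    rw [e, dbar_comb h hα fun _ => hZ]
    simp only [Finset.univ_unique, Finset.sum_singleton]
    rw [← mul_assoc, Complex.mul_conj, Complex.normSq_eq_norm_sq]
  rw [gap, gap, e2, Pi.smul_apply, map_smul, norm_smul, Complex.re_ofReal_mul]
  ring

theorem continuous_gap_comb [T2Space M] {ι : Type*} [Fintype ι] (h : HermitianMetric (2 * n + 1) M)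
    {α : OneForm (2 * n + 1) M} (hα : α.SmoothOnFields) (t : ℝ) {E : ι → CVField (2 * n + 1) M}
    (hE : ∀ i, (E i).IsSection S.T10) :
    Continuous fun x : M × (ι → ℂ) => S.gap h α t (CVField.comb E x.2) x.1 := by
  have h1 := hα.continuous_comb fun i => (hE i).1
  have h2 : Continuous fun x : M × (ι → ℂ) =>
      S.dbar h α (CVField.comb E x.2) (CVField.comb E x.2) x.1 := by
    simp only [dbar_comb h hα hE]
    refine continuous_finsetSum _ fun i _ => Continuous.mul (by fun_prop)
      (continuous_finsetSum _ fun j _ => Continuous.mul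
        (Complex.continuous_conj.comp (by fun_prop))
        ((continuous_dbar h hα (hE i) (hE j)).comp continuous_fst))
  unfold gap
  exact (continuous_const.mul (Complex.continuous_re.comp h2)).sub
    (continuous_const.mul (h1.norm.pow 2))

end CRStructure

namespace CRStructure

variable {n : ℕ} {M : Type*} [TopologicalSpace M]
  [ChartedSpace (EuclideanSpace ℝ (Fin (2 * n + 1))) M] [IsManifold (𝓡 (2 * n + 1)) ∞ M]
  {S : CRStructure n M}

/-! ### Changing the D'Angelo form by an exact form -/

theorem smoothOnFields_of_mem_dAngeloClass {α : OneForm (2 * n + 1) M} (hα : α ∈ S.dAngeloClass) :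
    α.SmoothOnFields := by
  obtain ⟨θ, hθ, T, hT, -, h⟩ := hα
  intro X hX
  simp only [h X hX]
  exact hθ.1.apply (hT.mlieBracket (ContMDiff.sub_section hX ((hθ.1.apply hX).smul_section hT)))

/-- The passage from `(θ, T)` to `(e^g θ, e^{-g} T)` changes `α_{θ,T}` to
`α_{θ,T} + dg - (T g) θ`. -/
theorem exists_add_diffForm_mem_dAngeloClass {α : OneForm (2 * n + 1) M} (hα : α ∈ S.dAngeloClass)
    {g : M → ℝ} (hg : ContMDiff (𝓡 (2 * n + 1)) 𝓘(ℝ, ℝ) ∞ g) :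
    ∃ θ, S.IsPseudoHermitian θ ∧ ∃ T : VField (2 * n + 1) M,
      (fun p => α p + diffForm g p - mvfderiv (𝓡 (2 * n + 1)) g p (T p) • θ p) ∈
        S.dAngeloClass := by
  obtain ⟨θ, hθ, T, hT, hθT, h⟩ := hα
  refine ⟨θ, hθ, T, fun p => Real.exp (g p) • θ p, ⟨?_, ?_, ?_⟩, fun p => Real.exp (-g p) • T p,
    ?_, ?_, ?_⟩
  · exact ContMDiff.smul_section (Real.contDiff_exp.contMDiff.comp hg) hθ.1
  · exact fun p => smul_ne_zero (Real.exp_pos _).ne' (hθ.2.1 p)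
  · intro p v hv
    have h1 := hθ.2.2 p v hv
    rw [OneForm.toComplex_apply] at h1 ⊢
    have h2 : ((Real.exp (g p) : ℝ) : ℂ) * (θ p v.re + Complex.I * θ p v.im) = 0 := by
      rw [h1, mul_zero]
    refine Eq.trans ?_ h2
    rw [smul_apply, smul_apply, smul_eq_mul, smul_eq_mul,
      Complex.ofReal_mul, Complex.ofReal_mul]
    ring
  · exact ContMDiff.smul_section (Real.contDiff_exp.contMDiff.comp hg.neg) hT
  · intro p
    rw [smul_apply, map_smul, hθT, smul_eq_mul, smul_eq_mul, mul_one,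
      ← Real.exp_add, add_neg_cancel, Real.exp_zero]
  · intro X hX p
    have hexp : ContMDiff (𝓡 (2 * n + 1)) 𝓘(ℝ, ℝ) ∞ fun q => Real.exp (-g q) :=
      Real.contDiff_exp.contMDiff.comp hg.neg
    -- the component of `X` in the kernel of `θ` along `T` is the same for both pairs
    have e1 : (fun q => X q - (Real.exp (g q) • θ q) (X q) • Real.exp (-g q) • T q) =
        fun q => X q - θ q (X q) • T q := by
      funext q
      rw [smul_apply, smul_smul, smul_eq_mul, mul_right_comm, ← Real.exp_add,
        add_neg_cancel, Real.exp_zero, one_mul]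
    rw [e1]
    set Y : VField (2 * n + 1) M := fun q => X q - θ q (X q) • T q with hY
    have e2 : VectorField.mlieBracket (𝓡 (2 * n + 1)) (fun q => Real.exp (-g q) • T q) Y p =
        -(mvfderiv (𝓡 (2 * n + 1)) (fun q => Real.exp (-g q)) p (Y p)) • T p +
          Real.exp (-g p) • VectorField.mlieBracket (𝓡 (2 * n + 1)) T Y p :=
      VectorField.mlieBracket_smul_left (hexp.mdifferentiableAt_top p) (hT.mdifferentiableAt p)
    have e3 : mvfderiv (𝓡 (2 * n + 1)) (fun q => Real.exp (-g q)) p (Y p) =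
        -(Real.exp (-g p) * mvfderiv (𝓡 (2 * n + 1)) g p (Y p)) := by
      rw [mvfderiv_real_comp_apply (u := fun x => Real.exp (-x)) (by fun_prop) hg]
      have : deriv (fun x => Real.exp (-x)) (g p) = -Real.exp (-g p) := by
        simpa using ((hasDerivAt_neg (g p)).exp).deriv
      rw [this]
      ring
    have e4 : mvfderiv (𝓡 (2 * n + 1)) g p (Y p) = mvfderiv (𝓡 (2 * n + 1)) g p (X p) -
        θ p (X p) * mvfderiv (𝓡 (2 * n + 1)) g p (T p) := by
      rw [hY, map_sub, map_smul, smul_eq_mul]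
    have e5 : Real.exp (g p) * Real.exp (-g p) = 1 := by
      rw [← Real.exp_add, add_neg_cancel, Real.exp_zero]
    have e6 : α p (X p) = θ p (VectorField.mlieBracket (𝓡 (2 * n + 1)) T Y p) := h X hX p
    rw [e2, e3, e4, smul_apply, map_add, map_smul, map_smul, hθT]
    simp only [sub_apply, add_apply, smul_apply, smul_eq_mul, e6, diffForm]
    linear_combination (-θ p (VectorField.mlieBracket (𝓡 (2 * n + 1)) T Y p) -
      (mvfderiv (𝓡 (2 * n + 1)) g p (X p) - θ p (X p) * mvfderiv (𝓡 (2 * n + 1)) g p (T p))) * e5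

/-- If `α'` agrees with `α` at `p` and with `α + dg` along `T^{1,0}M`, then `∂̄α'` and `∂̄α` differ
at `p` by the complex Hessian of `-g`. -/
theorem dbar_of_eq_add_diffForm (h : HermitianMetric (2 * n + 1) M)
    {α α' : OneForm (2 * n + 1) M} (hα : α.SmoothOnFields) {g : M → ℝ}
    (hg : ContMDiff (𝓡 (2 * n + 1)) 𝓘(ℝ, ℝ) ∞ g)
    (hT : ∀ q, ∀ v ∈ S.T10 q, α'.toComplex q v = α.toComplex q v + (diffForm g).toComplex q v)
    {p : M} (hp : α' p = α p) {Z W : CVField (2 * n + 1) M} (hZ : Z.IsSection S.T10)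
    (hW : W.IsSection S.T10) :
    S.dbar h α' Z W p = S.dbar h α Z W p -
      1 / 2 * W.conj.derivation (fun q => (diffForm g).toComplex q (Z q)) p := by
  have e1 : (fun q => α'.toComplex q (Z q)) =
      fun q => α.toComplex q (Z q) + (diffForm g).toComplex q (Z q) :=
    funext fun q => hT q _ (hZ.2 q)
  have e2 : S.form10 h α' p = S.form10 h α p := by
    simp only [form10, form01, OneForm.toComplex, hp]
  rw [dbar_eq h α' hZ hW, dbar_eq h α hZ hW, e1, e2, CVField.derivation_add
    (hα.toComplex_apply hZ.1) ((OneForm.SmoothOnFields.diffForm hg).toComplex_apply hZ.1)]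
  ring

end CRStructure

section

variable {d : ℕ} {M : Type*} [TopologicalSpace M] [ChartedSpace (EuclideanSpace ℝ (Fin d)) M]
  [IsManifold (𝓡 d) ∞ M]

/-! ### The oscillating potential -/

theorem toComplex_diffForm_const_mul {f : M → ℝ} (hf : ContMDiff (𝓡 d) 𝓘(ℝ, ℝ) ∞ f) (C : ℝ)
    (p : M) (v : CTangent d p) : (diffForm (fun q => C * f q) : OneForm d M).toComplex p v =
      C * (diffForm f : OneForm d M).toComplex p v := by
  have e : ∀ w, mvfderiv (𝓡 d) (fun q => C * f q) p w = C * mvfderiv (𝓡 d) f p w := fun w =>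
    mvfderiv_clm_comp_apply (ContinuousLinearMap.mul ℝ ℝ C) hf p w
  rw [OneForm.toComplex_apply, OneForm.toComplex_apply]
  simp only [diffForm, e]
  push_cast
  ring

/-- The function `-δ² ∑ sin² (f / δ)`, the sum being over the functions `f` in `s`. -/
noncomputable def oscillating (δ : ℝ) (s : Finset (M → ℝ)) (p : M) : ℝ :=
  ∑ f ∈ s, -(δ ^ 2 * Real.sin (δ⁻¹ * f p) ^ 2)

theorem contMDiff_oscillating (δ : ℝ) {s : Finset (M → ℝ)}
    (hs : ∀ f ∈ s, ContMDiff (𝓡 d) 𝓘(ℝ, ℝ) ∞ f) :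
    ContMDiff (𝓡 d) 𝓘(ℝ, ℝ) ∞ (oscillating δ s) := by
  refine contMDiff_finsetSum fun f hf => ?_
  have : ContDiff ℝ ∞ (fun x : ℝ => -(δ ^ 2 * Real.sin (δ⁻¹ * x) ^ 2)) := by fun_prop
  exact this.contMDiff.comp (hs f hf)

theorem mvfderiv_oscillating {δ : ℝ} (hδ : δ ≠ 0) {s : Finset (M → ℝ)}
    (hs : ∀ f ∈ s, ContMDiff (𝓡 d) 𝓘(ℝ, ℝ) ∞ f) (p : M) (v : TangentSpace (𝓡 d) p) :
    mvfderiv (𝓡 d) (oscillating δ s) p v =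
      ∑ f ∈ s, -(δ * Real.sin (2 * (δ⁻¹ * f p))) * mvfderiv (𝓡 d) f p v := by
  classical
  induction s using Finset.induction_on with
  | empty =>
    have : oscillating δ (∅ : Finset (M → ℝ)) = fun _ => (0 : ℝ) := by
      funext q; simp [oscillating]
    rw [this, mvfderiv_const]
    simp
  | insert f s hf ih =>
    have hs' : ∀ f ∈ s, ContMDiff (𝓡 d) 𝓘(ℝ, ℝ) ∞ f := fun f' hf' =>
      hs f' (Finset.mem_insert_of_mem hf')
    have hu : ContDiff ℝ ∞ (fun x : ℝ => -(δ ^ 2 * Real.sin (δ⁻¹ * x) ^ 2)) := by fun_prop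
    have hf1 := hs f (Finset.mem_insert_self f s)
    have e : oscillating δ (insert f s) =
        fun q => -(δ ^ 2 * Real.sin (δ⁻¹ * f q) ^ 2) + oscillating δ s q := by
      funext q; simp [oscillating, Finset.sum_insert hf]
    have hd : deriv (fun x : ℝ => -(δ ^ 2 * Real.sin (δ⁻¹ * x) ^ 2)) (f p) =
        -(δ * Real.sin (2 * (δ⁻¹ * f p))) := by
      have h1 : HasDerivAt (fun x : ℝ => δ⁻¹ * x) δ⁻¹ (f p) := by
        simpa using (hasDerivAt_id (f p)).const_mul δ⁻¹
      have h2 := (((h1.sin).pow 2).const_mul (δ ^ 2)).neg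
      refine h2.deriv.trans ?_
      rw [Real.sin_two_mul]
      field_simp
      norm_num
      ring
    have hf2 : ContMDiff (𝓡 d) 𝓘(ℝ, ℝ) ∞ fun q => -(δ ^ 2 * Real.sin (δ⁻¹ * f q) ^ 2) :=
      hu.contMDiff.comp hf1
    rw [e, mvfderiv_fun_add (hf2.mdifferentiableAt_top p)
      ((contMDiff_oscillating δ hs').mdifferentiableAt_top p), add_apply, ih hs',
      mvfderiv_real_comp_apply hu hf1, hd, Finset.sum_insert hf]

theorem diffForm_oscillating {δ : ℝ} (hδ : δ ≠ 0) {s : Finset (M → ℝ)}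
    (hs : ∀ f ∈ s, ContMDiff (𝓡 d) 𝓘(ℝ, ℝ) ∞ f) (p : M) (v : CTangent d p) :
    (diffForm (oscillating δ s) : OneForm d M).toComplex p v =
      ∑ f ∈ s, ((-(δ * Real.sin (2 * (δ⁻¹ * f p))) : ℝ) : ℂ) *
        (diffForm f : OneForm d M).toComplex p v := by
  rw [OneForm.toComplex_apply]
  simp only [diffForm, mvfderiv_oscillating hδ hs, Complex.ofReal_sum, Finset.mul_sum,
    ← Finset.sum_add_distrib]
  refine Finset.sum_congr rfl fun f _ => ?_
  rw [OneForm.toComplex_apply, Complex.ofReal_mul, Complex.ofReal_mul]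
  simp only [diffForm]
  ring

/-- The first derivatives of the oscillating potential are of size `δ`. -/
theorem norm_diffForm_oscillating_le {δ : ℝ} (hδ : 0 < δ) {s : Finset (M → ℝ)}
    (hs : ∀ f ∈ s, ContMDiff (𝓡 d) 𝓘(ℝ, ℝ) ∞ f) (p : M) (v : CTangent d p) :
    ‖(diffForm (oscillating δ s) : OneForm d M).toComplex p v‖ ≤
      δ * ∑ f ∈ s, ‖(diffForm f : OneForm d M).toComplex p v‖ := by
  rw [diffForm_oscillating hδ.ne' hs, Finset.mul_sum]
  refine (norm_sum_le _ _).trans (Finset.sum_le_sum fun f _ => ?_)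
  rw [norm_mul, Complex.norm_real, norm_neg, norm_mul, Real.norm_of_nonneg hδ.le]
  refine mul_le_mul_of_nonneg_right ?_ (norm_nonneg _)
  exact mul_le_of_le_one_right hδ.le (Real.abs_sin_le_one _)

theorem diffForm_oscillating_eq_zero {δ : ℝ} (hδ : δ ≠ 0) {s : Finset (M → ℝ)}
    (hs : ∀ f ∈ s, ContMDiff (𝓡 d) 𝓘(ℝ, ℝ) ∞ f) {p : M} (hp : ∀ f ∈ s, f p = 0) :
    (diffForm (oscillating δ s) : OneForm d M) p = 0 := by
  ext v
  refine (mvfderiv_oscillating hδ hs p v).trans (Finset.sum_eq_zero fun f hf => ?_)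
  rw [hp f hf]
  simp

/-- The second derivatives of the oscillating potential at the common zeros of the functions do not
depend on `δ`. -/
theorem derivation_diffForm_oscillating {δ : ℝ} (hδ : δ ≠ 0) {s : Finset (M → ℝ)}
    (hs : ∀ f ∈ s, ContMDiff (𝓡 d) 𝓘(ℝ, ℝ) ∞ f) {p : M} (hp : ∀ f ∈ s, f p = 0)
    {Z : CVField d M} (hZ : Z.Smooth) :
    Z.conj.derivation (fun q => (diffForm (oscillating δ s) : OneForm d M).toComplex q (Z q)) p =
      -(2 * ∑ f ∈ s, (‖(diffForm f : OneForm d M).toComplex p (Z p)‖ : ℂ) ^ 2) := by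
  classical
  simp only [diffForm_oscillating hδ hs]
  have hu : ContDiff ℝ ∞ (fun x : ℝ => -(δ * Real.sin (2 * (δ⁻¹ * x)))) := by fun_prop
  have hterm : ∀ f : s, ContMDiff (𝓡 d) 𝓘(ℝ, ℂ) ∞ fun q =>
      ((-(δ * Real.sin (2 * (δ⁻¹ * f.1 q))) : ℝ) : ℂ) :=
    fun f => contMDiff_ofReal (hu.contMDiff.comp (hs f.1 f.2))
  have hdf : ∀ f : s, ContMDiff (𝓡 d) 𝓘(ℝ, ℂ) ∞ fun q =>
      (diffForm f.1 : OneForm d M).toComplex q (Z q) :=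
    fun f => (OneForm.SmoothOnFields.diffForm (hs f.1 f.2)).toComplex_apply hZ
  have e : (fun q => ∑ f ∈ s, ((-(δ * Real.sin (2 * (δ⁻¹ * f q))) : ℝ) : ℂ) *
      (diffForm f : OneForm d M).toComplex q (Z q)) = fun q => ∑ f : s,
        ((-(δ * Real.sin (2 * (δ⁻¹ * f.1 q))) : ℝ) : ℂ) *
          (diffForm f.1 : OneForm d M).toComplex q (Z q) :=
    funext fun q => (Finset.sum_coe_sort s fun f =>
      ((-(δ * Real.sin (2 * (δ⁻¹ * f q))) : ℝ) : ℂ) *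
        (diffForm f : OneForm d M).toComplex q (Z q)).symm
  rw [e, CVField.derivation_sum _ _ fun f => (hterm f).complex_mul (hdf f), Finset.mul_sum,
    ← Finset.sum_neg_distrib, ← Finset.sum_coe_sort s]
  refine Finset.sum_congr rfl fun f _ => ?_
  have hd : deriv (fun x : ℝ => -(δ * Real.sin (2 * (δ⁻¹ * x)))) 0 = -2 := by
    have h1 : HasDerivAt (fun x : ℝ => 2 * (δ⁻¹ * x)) (2 * δ⁻¹) 0 := by
      simpa using ((hasDerivAt_id (0 : ℝ)).const_mul δ⁻¹).const_mul 2
    refine ((h1.sin.const_mul δ).neg).deriv.trans ?_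
    simp
    field_simp
  have hchain : ∀ v : TangentSpace (𝓡 d) p, mvfderiv (𝓡 d) (fun q =>
      ((-(δ * Real.sin (2 * (δ⁻¹ * f.1 q))) : ℝ) : ℂ)) p v =
        -2 * (mvfderiv (𝓡 d) f.1 p v : ℝ) := fun v => by
    refine (mvfderiv_clm_comp_apply Complex.ofRealCLM (hu.contMDiff.comp (hs f.1 f.2)) p v).trans ?_
    have h1 := mvfderiv_real_comp_apply hu (hs f.1 f.2) p v
    rw [hp f.1 f.2, hd] at h1
    refine (congrArg Complex.ofReal h1).trans ?_
    push_cast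
    ring
  have hderiv : Z.conj.derivation (fun q => ((-(δ * Real.sin (2 * (δ⁻¹ * f.1 q))) : ℝ) : ℂ)) p =
      -2 * starRingEnd ℂ ((diffForm f.1 : OneForm d M).toComplex p (Z p)) := by
    rw [← OneForm.toComplex_conj, OneForm.toComplex_apply, CVField.derivation, hchain, hchain]
    simp only [CVField.conj, diffForm]
    ring
  rw [CVField.derivation_mul (hterm f) (hdf f), hderiv, hp f.1 f.2, ← Complex.mul_conj']
  simp
  ring

end

namespace CRStructure

variable {n : ℕ} {M : Type*} [TopologicalSpace M]
  [ChartedSpace (EuclideanSpace ℝ (Fin (2 * n + 1))) M] [IsManifold (𝓡 (2 * n + 1)) ∞ M]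
  {S : CRStructure n M}

/-! ### From the derived distribution to the distribution -/

/-- If `conj(α_{0,1}) ∧ α_{0,1} < t ∂̄α` on the derived distribution `D'`, then on `D` the failure
of the inequality is compensated by the squares of the differentials of finitely many functions
vanishing on the support of `D`. -/
theorem exists_finset_of_hermitianLT_derived [T2Space M] [CompactSpace M]
    (h : HermitianMetric (2 * n + 1) M) {α : OneForm (2 * n + 1) M} (hα : α.SmoothOnFields) {t : ℝ}
    (ht : 0 < t) {D : CDistribution (2 * n + 1) M} (hD : S.IsClosedDistribution D)
    (hlt : S.HermitianLT h α t D.derived) :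
    ∃ s : Finset (M → ℝ), (∀ f ∈ s, ContMDiff (𝓡 (2 * n + 1)) 𝓘(ℝ, ℝ) ∞ f ∧
        ∀ q ∈ D.support, f q = 0) ∧
      ∀ Z : CVField (2 * n + 1) M, Z.IsSection S.T10 → ∀ p, Z p ∈ D p → Z p ≠ 0 →
        0 < S.gap h α t Z p + t * ∑ f ∈ s, ‖(diffForm f).toComplex p (Z p)‖ ^ 2 := by
  classical
  rw [hermitianLT_iff] at hlt
  let I := {s : Finset (M → ℝ) // ∀ f ∈ s, ContMDiff (𝓡 (2 * n + 1)) 𝓘(ℝ, ℝ) ∞ f ∧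
    ∀ q ∈ D.support, f q = 0}
  have : Nonempty I := ⟨⟨∅, by simp⟩⟩
  refine Exists.elim (exists_index_of_local (S := S) (I := I) (fun s q v => v ∈ D q →
    ∀ Z : CVField (2 * n + 1) M, Z.IsSection S.T10 → Z q = v →
      0 < S.gap h α t Z q + t * ∑ f ∈ s.1, ‖(diffForm f).toComplex q v‖ ^ 2) ?_ ?_ ?_)
    fun s hs => ?_
  · intro s s'
    refine ⟨⟨s.1 ∪ s'.1, fun f hf => (Finset.mem_union.1 hf).elim (s.2 f) (s'.2 f)⟩,
      fun q v hor hv Z hZ hZv => ?_⟩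
    rcases hor with hor | hor
    · refine (hor hv Z hZ hZv).trans_le ?_
      gcongr
      exact Finset.subset_union_left
    · refine (hor hv Z hZ hZv).trans_le ?_
      gcongr
      exact Finset.subset_union_right
  · intro s q v r hr hP hv Z hZ hZv
    have h1 := hP ((D q).smul_mem _ hv) ((r : ℂ) • Z) (hZ.smul _) (by rw [← hZv]; rfl)
    rw [gap_smul h hα t hZ] at h1
    simp only [map_smul, norm_smul, mul_pow, ← Finset.mul_sum] at h1
    have h2 : 0 < ‖(r : ℂ)‖ ^ 2 * (S.gap h α t Z q +
        t * ∑ f ∈ s.1, ‖(diffForm f).toComplex q v‖ ^ 2) := by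
      rw [mul_add]
      linarith [mul_left_comm t (‖(r : ℂ)‖ ^ 2) (∑ f ∈ s.1, ‖(diffForm f).toComplex q v‖ ^ 2)]
    exact pos_of_mul_pos_right h2 (by positivity)
  · intro E hE p c hne
    by_cases hmem : CVField.comb E c p ∈ D p
    swap
    · refine ⟨⟨∅, by simp⟩, ?_⟩
      filter_upwards [(hD E hE).isOpen_compl.mem_nhds hmem] with x hx hx'
      exact absurd hx' hx
    -- at a point of the derived distribution no function is needed; otherwise a multiple of a
    -- single function suffices
    have hpt : ∃ s : I, 0 < S.gap h α t (CVField.comb E c) p +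
        t * ∑ f ∈ s.1, ‖(diffForm f).toComplex p (CVField.comb E c p)‖ ^ 2 := by
      by_cases hgap : 0 < S.gap h α t (CVField.comb E c) p
      · exact ⟨⟨∅, by simp⟩, by simpa using hgap⟩
      · have hnot : CVField.comb E c p ∉ D.derived p := fun hd =>
          hgap (hlt _ (CVField.IsSection.comb hE c) p hd hne)
        have hnot2 : CVField.comb E c p ∉ Complexified.ofReal (tangentToSet D.support p) :=
          fun hd => hnot ⟨hmem, hd⟩
        rw [mem_ofReal_tangentToSet] at hnot2
        push Not at hnot2
        obtain ⟨f, hf, hfD, hne0⟩ := hnot2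
        set b := ‖(diffForm f).toComplex p (CVField.comb E c p)‖ ^ 2 with hb
        have hbpos : 0 < b := by positivity
        obtain ⟨C, hC⟩ := exists_nat_gt ((1 - S.gap h α t (CVField.comb E c) p) / (t * b))
        rw [div_lt_iff₀ (by positivity)] at hC
        have hC1 : (C : ℝ) ≤ (C : ℝ) ^ 2 := by
          exact_mod_cast Nat.le_self_pow two_ne_zero C
        refine ⟨⟨{fun q => (C : ℝ) * f q}, fun f' hf' => ?_⟩, ?_⟩
        · rw [Finset.mem_singleton.1 hf']
          exact ⟨contMDiff_const.mul hf, fun q hq => by simp only [hfD q hq, mul_zero]⟩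
        · simp only [Finset.sum_singleton]
          rw [toComplex_diffForm_const_mul hf, norm_mul, mul_pow, ← hb, Complex.norm_real,
            Real.norm_natCast]
          nlinarith [mul_le_mul_of_nonneg_right hC1 (mul_pos ht hbpos).le]
    obtain ⟨s, hs⟩ := hpt
    refine ⟨s, ?_⟩
    have hcont : Continuous fun x : M × (Fin n → ℂ) => S.gap h α t (CVField.comb E x.2) x.1 +
        t * ∑ f ∈ s.1, ‖(diffForm f).toComplex x.1 (CVField.comb E x.2 x.1)‖ ^ 2 :=
      (continuous_gap_comb h hα t hE).add (continuous_const.mul (continuous_finsetSum _ fun f hf =>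
        ((OneForm.SmoothOnFields.diffForm (s.2 f hf).1).continuous_comb
          fun i => (hE i).1).norm.pow 2))
    filter_upwards [hcont.continuousAt.eventually (lt_mem_nhds hs)] with x hx _ Z hZ hZv
    rwa [gap_congr h hα t hZ (CVField.IsSection.comb hE x.2) hZv]
  · exact ⟨s.1, s.2, fun Z hZ p hp h0 => hs p _ (hZ.2 p) h0 hp Z hZ rfl⟩

/-- On the compact manifold the differential of a smooth function is bounded on the `h`-unit vectors
of `T^{1,0}M`. -/
theorem exists_norm_diffForm_le [T2Space M] [CompactSpace M] (h : HermitianMetric (2 * n + 1) M)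
    {s : Finset (M → ℝ)} (hs : ∀ f ∈ s, ContMDiff (𝓡 (2 * n + 1)) 𝓘(ℝ, ℝ) ∞ f) :
    ∃ B : ℝ, 0 ≤ B ∧ ∀ q, ∀ v ∈ S.T10 q, (h.core q).inner v v = 1 →
      ∑ f ∈ s, ‖(diffForm f).toComplex q v‖ ≤ B := by
  refine Exists.elim (exists_index_of_local (S := S) (I := ℕ) (fun B q v =>
    ∑ f ∈ s, ‖(diffForm f).toComplex q v‖ ^ 2 ≤ B * ((h.core q).inner v v).re) ?_ ?_ ?_)
    fun B hB => ?_
  · intro i j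
    refine ⟨max i j, fun q v hor => ?_⟩
    have h0 := h.inner_self_nonneg q v
    rcases hor with hor | hor
    · exact hor.trans (mul_le_mul_of_nonneg_right (by exact_mod_cast le_max_left i j) h0)
    · exact hor.trans (mul_le_mul_of_nonneg_right (by exact_mod_cast le_max_right i j) h0)
  · intro i q v r hr hP
    rw [h.inner_smul_self] at hP
    simp only [map_smul, norm_smul, mul_pow, ← Finset.mul_sum] at hP
    have hr2 : 0 < ‖(r : ℂ)‖ ^ 2 := by
      have : (r : ℂ) ≠ 0 := by exact_mod_cast hr.ne'
      positivity
    rw [mul_left_comm] at hP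
    exact le_of_mul_le_mul_left hP hr2
  · intro E hE p c hne
    have hpos := h.inner_self_pos hne
    obtain ⟨B, hB⟩ := exists_nat_gt (
      (∑ f ∈ s, ‖(diffForm f).toComplex p (CVField.comb E c p)‖ ^ 2) /
        ((h.core p).inner (CVField.comb E c p) (CVField.comb E c p)).re)
    rw [div_lt_iff₀ hpos] at hB
    refine ⟨B, ?_⟩
    have h1 : Continuous fun x : M × (Fin n → ℂ) =>
        ∑ f ∈ s, ‖(diffForm f).toComplex x.1 (CVField.comb E x.2 x.1)‖ ^ 2 :=
      continuous_finsetSum _ fun f hf =>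
        ((OneForm.SmoothOnFields.diffForm (hs f hf)).continuous_comb
          fun i => (hE i).1).norm.pow 2
    have h2 : Continuous fun x : M × (Fin n → ℂ) => (B : ℝ) *
        ((h.core x.1).inner (CVField.comb E x.2 x.1) (CVField.comb E x.2 x.1)).re :=
      continuous_const.mul (Complex.continuous_re.comp (h.continuous_comb fun i => (hE i).1))
    filter_upwards [h1.continuousAt.eventually_lt h2.continuousAt hB] with x hx
    exact hx.le
  · refine ⟨∑ f ∈ s, (1 + B), by positivity, fun q v hv h1 => ?_⟩
    have hv0 : v ≠ 0 := by
      rintro rfl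
      have := (h.core q).smul_left 0 0 0
      rw [zero_smul, map_zero, zero_mul, h1] at this
      exact one_ne_zero this
    have h2 := hB q v hv hv0
    rw [h1, Complex.one_re, mul_one] at h2
    refine Finset.sum_le_sum fun f hf => ?_
    -- `x ≤ 1 + x²`
    have h3 := (Finset.single_le_sum (f := fun f => ‖(diffForm f).toComplex q v‖ ^ 2)
      (fun f _ => by positivity) hf).trans h2
    nlinarith [sq_nonneg (‖(diffForm f).toComplex q v‖ - 1)]

theorem leviDistribution_le_T10 (p : M) : S.leviDistribution p ≤ S.T10 p := by
  rintro v ⟨Z, hZ, rfl, -⟩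
  exact hZ.2 p

/-- A D'Angelo form `α` of size less than `K` that satisfies `conj(α_{0,1}) ∧ α_{0,1} < t ∂̄α` on
the derived distribution `D'` can be changed, by a small exact form along `T^{1,0}M`, to one that
satisfies the inequality on `D`. -/
theorem exists_hermitianLT_of_derived [T2Space M] [CompactSpace M]
    (h : HermitianMetric (2 * n + 1) M) {K : ℝ≥0∞} {t : ℝ} (ht : 0 < t)
    {D : CDistribution (2 * n + 1) M} (hD : S.IsClosedDistribution D)
    (hlt : ∃ α ∈ S.dAngeloClass, h.size S.leviDistribution α < K ∧ S.HermitianLT h α t D.derived) :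
    ∃ α ∈ S.dAngeloClass, h.size S.leviDistribution α < K ∧ S.HermitianLT h α t D := by
  obtain ⟨α, hα, hK, hlt⟩ := hlt
  have hαs := smoothOnFields_of_mem_dAngeloClass hα
  obtain ⟨s, hs, hsD⟩ := exists_finset_of_hermitianLT_derived h hαs ht hD hlt
  have hs1 : ∀ f ∈ s, ContMDiff (𝓡 (2 * n + 1)) 𝓘(ℝ, ℝ) ∞ f := fun f hf => (hs f hf).1
  obtain ⟨B, hB0, hB⟩ := exists_norm_diffForm_le (S := S) h hs1
  -- the room left between the size of `α` and `K`
  obtain ⟨ε, hε, hεK⟩ : ∃ ε : ℝ, 0 < ε ∧ h.size S.leviDistribution α + ENNReal.ofReal ε < K := by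
    obtain ⟨r, hr0, hr⟩ := ENNReal.lt_iff_exists_add_pos_lt.1 hK
    exact ⟨r, hr0, by rwa [ENNReal.ofReal_coe_nnreal]⟩
  -- the change of `α` on unit vectors is at most `δ * B`
  set δ : ℝ := ε / (B + 1) with hδdef
  have hδ : 0 < δ := by positivity
  have hg := contMDiff_oscillating (d := 2 * n + 1) δ hs1
  obtain ⟨θ, hθ, T, hα'⟩ := exists_add_diffForm_mem_dAngeloClass hα hg
  set α' : OneForm (2 * n + 1) M := fun p => α p + diffForm (oscillating δ s) p -
    mvfderiv (𝓡 (2 * n + 1)) (oscillating δ s) p (T p) • θ p with hα'def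
  have hT10 : ∀ q, ∀ v ∈ S.T10 q, α'.toComplex q v =
      α.toComplex q v + (diffForm (oscillating δ s)).toComplex q v := by
    intro q v hv
    have h1 := hθ.2.2 q v hv
    rw [OneForm.toComplex_apply] at h1
    rw [OneForm.toComplex_apply, OneForm.toComplex_apply, OneForm.toComplex_apply, hα'def]
    simp only [sub_apply, add_apply, smul_apply, smul_eq_mul, Complex.ofReal_sub,
      Complex.ofReal_add, Complex.ofReal_mul]
    linear_combination
      -((mvfderiv (𝓡 (2 * n + 1)) (oscillating δ s) q (T q) : ℝ) : ℂ) * h1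
  refine ⟨α', hα', lt_of_le_of_lt ?_ hεK, ?_⟩
  · refine iSup_le fun p => iSup_le fun v => iSup_le fun hv => iSup_le fun hv1 => ?_
    have hvT := leviDistribution_le_T10 p hv
    rw [hT10 p v hvT]
    refine (enorm_add_le _ _).trans (add_le_add ?_ ?_)
    · exact le_iSup_of_le p (le_iSup_of_le v (le_iSup_of_le hv (le_iSup_of_le hv1 le_rfl)))
    · rw [← ofReal_norm]
      refine ENNReal.ofReal_le_ofReal ((norm_diffForm_oscillating_le hδ hs1 p v).trans ?_)
      refine (mul_le_mul_of_nonneg_left (hB p v hvT hv1) hδ.le).trans ?_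
      rw [hδdef, div_mul_eq_mul_div, div_le_iff₀ (by positivity)]
      nlinarith
  · rw [hermitianLT_iff]
    intro Z hZ p hp h0
    have hzero : ∀ f ∈ s, f p = 0 := fun f hf =>
      (hs f hf).2 p fun hbot => h0 (by rw [hbot] at hp; exact hp)
    have hdg := diffForm_oscillating_eq_zero hδ.ne' hs1 hzero
    have hαp : α' p = α p := by
      have hTg : mvfderiv (𝓡 (2 * n + 1)) (oscillating δ s) p (T p) = 0 :=
        congrArg (fun L : TangentSpace (𝓡 (2 * n + 1)) p →L[ℝ] ℝ => L (T p)) hdg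
      rw [hα'def]
      simp only [hdg, hTg, add_zero, zero_smul, sub_zero]
    have hd := dbar_of_eq_add_diffForm h hαs hg hT10 hαp hZ hZ
    rw [derivation_diffForm_oscillating hδ.ne' hs1 hzero hZ.1] at hd
    have hre : (S.dbar h α' Z Z p).re =
        (S.dbar h α Z Z p).re + ∑ f ∈ s, ‖(diffForm f).toComplex p (Z p)‖ ^ 2 := by
      rw [hd, ← Complex.ofReal_re (∑ f ∈ s, ‖(diffForm f).toComplex p (Z p)‖ ^ 2), ← Complex.add_re]
      congr 1
      push_cast
      ring
    have h1 := hsD Z hZ p hp h0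
    have h2 : α'.toComplex p (Z p) = α.toComplex p (Z p) := by
      simp only [OneForm.toComplex, hαp]
    rw [gap] at h1 ⊢
    rw [hre, h2]
    linarith

/-! ### Transfinite induction -/

/-- If `conj(α_{0,1}) ∧ α_{0,1} < t ∂̄α` on the intersection of a decreasing sequence of closed
distributions, then the inequality already holds on a member of the sequence. -/
theorem exists_hermitianLT_of_limit [T2Space M] [CompactSpace M]
    (h : HermitianMetric (2 * n + 1) M) {α : OneForm (2 * n + 1) M} (hα : α.SmoothOnFields) {t : ℝ}
    {D : CDistribution (2 * n + 1) M} (hD : S.IsClosedDistribution D) {o : Ordinal.{0}}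
    (ho : Order.IsSuccLimit o) (hlt : S.HermitianLT h α t (D.iterDerived o)) :
    ∃ b < o, S.HermitianLT h α t (D.iterDerived b) := by
  simp only [hermitianLT_iff] at hlt ⊢
  have : Nonempty (Set.Iio o) := ⟨⟨0, ho.bot_lt⟩⟩
  refine Exists.elim (exists_index_of_local (S := S) (I := Set.Iio o) (fun b q v =>
    v ∈ D.iterDerived b.1 q → ∀ Z : CVField (2 * n + 1) M, Z.IsSection S.T10 → Z q = v →
      0 < S.gap h α t Z q) ?_ ?_ ?_) fun b hb => ?_
  · intro i j
    refine ⟨max i j, fun q v hor hv => ?_⟩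
    rcases hor with hor | hor
    · exact hor (D.iterDerived_antitone (le_max_left i j) q hv)
    · exact hor (D.iterDerived_antitone (le_max_right i j) q hv)
  · intro b q v r hr hP hv Z hZ hZv
    have h1 := hP (Submodule.smul_mem _ _ hv) ((r : ℂ) • Z) (hZ.smul _) (by rw [← hZv]; rfl)
    rw [gap_smul h hα t hZ] at h1
    exact pos_of_mul_pos_right h1 (by positivity)
  · intro E hE p c hne
    by_cases hmem : CVField.comb E c p ∈ D.iterDerived o p
    · refine ⟨⟨0, ho.bot_lt⟩, ?_⟩
      have hpos := hlt _ (CVField.IsSection.comb hE c) p hmem hne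
      filter_upwards [(continuous_gap_comb h hα t hE).continuousAt.eventually (lt_mem_nhds hpos)]
        with x hx _ Z hZ hZv
      rwa [gap_congr h hα t hZ (CVField.IsSection.comb hE x.2) hZv]
    · rw [D.mem_iterDerived_limit ho] at hmem
      push Not at hmem
      obtain ⟨b, hb, hnot⟩ := hmem
      refine ⟨⟨b, hb⟩, ?_⟩
      filter_upwards [(hD.iterDerived b E hE).isOpen_compl.mem_nhds hnot] with x hx hx'
      exact absurd hx' hx
  · exact ⟨b.1, b.2, fun Z hZ p hp h0 => hb p _ (hZ.2 p) h0 hp Z hZ rfl⟩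

theorem exists_hermitianLT_of_iterDerived [T2Space M] [CompactSpace M]
    (h : HermitianMetric (2 * n + 1) M) {K : ℝ≥0∞} {t : ℝ} (ht : 0 < t)
    {D : CDistribution (2 * n + 1) M} (hD : S.IsClosedDistribution D) (o : Ordinal.{0}) :
    (∃ α ∈ S.dAngeloClass, h.size S.leviDistribution α < K ∧
      S.HermitianLT h α t (D.iterDerived o)) →
    ∃ α ∈ S.dAngeloClass, h.size S.leviDistribution α < K ∧ S.HermitianLT h α t D := by
  induction o using Ordinal.limitRecOn with
  | zero => rw [CDistribution.iterDerived_zero]; exact id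
  | add_one b ih =>
    rw [CDistribution.iterDerived_add_one]
    exact fun hlt => ih (exists_hermitianLT_of_derived h ht (hD.iterDerived b) hlt)
  | limit o ho ih =>
    rintro ⟨α, hα, hK, hlt⟩
    obtain ⟨b, hb, hlt⟩ := exists_hermitianLT_of_limit h (smoothOnFields_of_mem_dAngeloClass hα) hD
      ho hlt
    exact ih b hb ⟨α, hα, hK, hlt⟩

end CRStructure

theorem mainTheorem1 {n : ℕ} (hn : 1 ≤ n) {M : Type*} [TopologicalSpace M] [T2Space M]
    [CompactSpace M] [ConnectedSpace M]
    [ChartedSpace (EuclideanSpace ℝ (Fin (2 * n + 1))) M] [IsManifold (𝓡 (2 * n + 1)) ∞ M]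
    (S : CRStructure n M) (hS : S.IsPseudoconvex) (h : HermitianMetric (2 * n + 1) M)
    {K : ℝ≥0∞} (hK : 0 < K) :
    S.nK h K S.leviDistribution = S.nK h K S.leviDistribution.core := by
  apply le_antisymm
  · refine le_iInf fun α => le_iInf fun hα => le_iInf fun hαK => le_iInf fun t => le_iInf fun ht =>
      le_iInf fun hlt => ?_
    obtain ⟨α', hα', hαK', hlt'⟩ := CRStructure.exists_hermitianLT_of_iterDerived h ht
      (CRStructure.isClosedDistribution_leviDistribution h) _ ⟨α, hα, hαK, hlt⟩
    exact iInf_le_of_le α' (iInf_le_of_le hα' (iInf_le_of_le hαK' (iInf_le_of_le t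
      (iInf_le_of_le ht (iInf_le_of_le hlt' le_rfl)))))
  · refine iInf_mono fun α => iInf_mono fun _ => iInf_mono fun _ => iInf_mono fun t =>
      iInf_mono fun _ => ?_
    exact iInf_mono' fun hlt => ⟨fun Z hZ p hp => hlt Z hZ p (CDistribution.core_le _ p hp), le_rfl⟩
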